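/- For $\pi\in S_n$, let $\mathsf{runsort}(\pi)\in S_n$ be the permutation obtained from $\pi$ by rearranging its ascending runs (maximal consecutive increasing subsequences) so that their smallest entries appear in increasing order. For $\sigma\in S_n$, let $\gamma_\sigma$ be the measure on $[0,1]^2$ that has density $n$ on $\bigcup_{i=1}^n\left[\frac{i-1}n,\frac in\right)\times\left[\frac{\sigma_i-1}n,\frac{\sigma_i}n\right)$ and density $0$ elsewhere. Let $\pi$ be uniformly distributed in $S_n$, let $p_n(i,j)$ be the probability that $\mathsf{runsort}(\pi)$ has the entry $j$ in position $i$, and for $B=[x_1,x_2]\times[y_1,y_2]\subseteq[0,1]^2$ put $$E_n(B)=\frac1n\sum_{\substack{x_1n<i\le x_2n\\ y_1n<j\le y_2n}}p_n(i,j).$$ Let $\mathbf R_n=\mathbb E[\gamma_{\mathsf{runsort}(\pi)}]$ be the expected measure; thus $\mathbf R_n(B)=E_n(B)$ for every rectangle $B$ whose vertices have coordinates that are integer multiples of $1/n$. Let $\mathcal C=\{(x,y)\in[0,1]^2:x=ye^{1-y}\}$ and $\mathcal C^+=\{(x,y)\in[0,1]^2:x<ye^{1-y}\}$, and let $\mathbf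 R$ be the measure $$\mathbf R(B)=\int_{B\cap\mathcal C^+}e^{y-1}\,dx\,dy+\int_{B\cap\mathcal C}(1-y)\,dy,$$ where in the second integral the curve $\mathcal C$ is parametrized by $y\in[0,1]$. Theorem. The measures $\mathbf R_n$ converge to $\mathbf R$ as $n\to\infty$. That is, for every axis-parallel rectangle $B=[x_1,x_2]\times[y_1,y_2]\subseteq[0,1]^2$, $$\lim_{n\to\infty}E_n(B)=\lim_{n\to\infty}\mathbf R_n(B)=\mathbf R(B),$$ and moreover $d_\square(\mathbf R_n,\mathbf R)=\sup_B|\mathbf R_n(B)-\mathbf R(B)|\to0$, where the supremum is over all such rectangles $B$. -/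

import Mathlib

namespace RunsortPermuton

open MeasureTheory Set Filter Topology
open scoped ENNReal

/-! Permutations of `[n]` are `Equiv.Perm (Fin n)`: position `i` and value `π i` of `Fin n` stand for
the position `i + 1` and the entry `π i + 1` of the usual one-line notation. -/

/-- The positions of the ascending run of `π` (maximal block of consecutive positions along which `π`
increases) that contains the position `i`: all `j` such that `π` increases on all the positions
between `i` and `j`, both included. -/
def run {n : ℕ} (π : Equiv.Perm (Fin n)) (i : Fin n) : Finset (Fin n) :=
  Finset.univ.filter fun j =>
    ∀ a ∈ Finset.uIcc i j, ∀ b ∈ Finset.uIcc i j, a < b → π a < π b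

theorem self_mem_run {n : ℕ} (π : Equiv.Perm (Fin n)) (i : Fin n) : i ∈ run π i := by
  simp only [run, Finset.mem_filter, Finset.mem_univ, true_and, Finset.uIcc_self,
    Finset.mem_singleton]
  rintro a rfl b rfl h
  exact absurd h (lt_irrefl _)

/-- The smallest entry of the run of `π` that contains the position `i`. -/
def runMin {n : ℕ} (π : Equiv.Perm (Fin n)) (i : Fin n) : Fin n :=
  (run π i).inf' ⟨i, self_mem_run π i⟩ π

/-- `runsort π`: the runs of `π` are rearranged so that their smallest entries appear in increasing
order, the order inside each run being kept. (`Tuple.sort` is the stable sort: it lists the positions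
`i` in the lexicographic order of the pairs `(runMin π i, i)`.) -/
def runsort {n : ℕ} (π : Equiv.Perm (Fin n)) : Equiv.Perm (Fin n) :=
  π * Tuple.sort (runMin π)

/-- The measure `γ_π` on the unit square (as a measure on the plane): its density is `n` on the
`n` cells `[i/n, (i+1)/n) × [π i/n, (π i + 1)/n)`, `i = 0, …, n - 1`, and `0` elsewhere. -/
noncomputable def gamma {n : ℕ} (π : Equiv.Perm (Fin n)) : Measure (ℝ × ℝ) :=
  volume.withDensity
    ((⋃ i : Fin n,
      Ico ((i : ℝ) / n) (((i : ℝ) + 1) / n) ×ˢ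
        Ico ((π i : ℝ) / n) (((π i : ℝ) + 1) / n)).indicator fun _ => (n : ℝ≥0∞))

/-- The probability that `runsort π` has the entry `j` in position `i`, for `π` uniform in `S_n`. -/
noncomputable def p (n : ℕ) (i j : Fin n) : ℝ :=
  ((Finset.univ.filter fun π : Equiv.Perm (Fin n) => runsort π i = j).card : ℝ) / n.factorial

open Classical in
/-- `E_n([x₁, x₂] × [y₁, y₂])`: `1/n` times the sum of the probabilities that the entry `j` is in
position `i`, over `x₁ n < i ≤ x₂ n` and `y₁ n < j ≤ y₂ n` (`i, j` counted from `1`). -/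
noncomputable def E (n : ℕ) (x₁ x₂ y₁ y₂ : ℝ) : ℝ :=
  1 / (n : ℝ) * ∑ i : Fin n, ∑ j : Fin n,
    if (x₁ * n < (i : ℝ) + 1 ∧ (i : ℝ) + 1 ≤ x₂ * n) ∧
        (y₁ * n < (j : ℝ) + 1 ∧ (j : ℝ) + 1 ≤ y₂ * n)
    then p n i j else 0

/-- The expectation of the random measure `γ_{runsort π}`, for `π` uniform in `S_n`. -/
noncomputable def meanMeasure (n : ℕ) : Measure (ℝ × ℝ) :=
  (n.factorial : ℝ≥0∞)⁻¹ • ∑ π : Equiv.Perm (Fin n), gamma (runsort π)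

/-- The region `C⁺ = {(x, y) ∈ [0,1]² : x < y e^{1-y}}`. -/
def Cplus : Set (ℝ × ℝ) :=
  {q | q ∈ Icc (0 : ℝ) 1 ×ˢ Icc (0 : ℝ) 1 ∧ q.1 < q.2 * Real.exp (1 - q.2)}

/-- The runsort permuton: the sum of the measure with density `e^{y-1}` on `C⁺` and of the measure
`(1 - y) dy` on the curve `C = {(x, y) ∈ [0,1]² : x = y e^{1-y}}`, which is parametrized by
`y ∈ [0,1]`. -/
noncomputable def R : Measure (ℝ × ℝ) :=
  (volume.restrict Cplus).withDensity (fun q => ENNReal.ofReal (Real.exp (q.2 - 1))) +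
  ((volume.restrict (Icc (0 : ℝ) 1)).withDensity (fun y => ENNReal.ofReal (1 - y))).map
    (fun y : ℝ => (y * Real.exp (1 - y), y))

/-- Axis-parallel rectangles in the unit square. -/
def IsRect (B : Set (ℝ × ℝ)) : Prop :=
  ∃ x₁ x₂ y₁ y₂ : ℝ, 0 ≤ x₁ ∧ x₁ ≤ x₂ ∧ x₂ ≤ 1 ∧ 0 ≤ y₁ ∧ y₁ ≤ y₂ ∧ y₂ ≤ 1 ∧
    B = Icc x₁ x₂ ×ˢ Icc y₁ y₂

/-- The rectangle distance `d_□(γ₁, γ₂) = sup_B |γ₁(B) - γ₂(B)|` of finite measures. -/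
noncomputable def dSquare (γ₁ γ₂ : Measure (ℝ × ℝ)) : ℝ≥0∞ :=
  ⨆ (B : Set (ℝ × ℝ)) (_ : IsRect B), ENNReal.ofReal |γ₁.real B - γ₂.real B|

end RunsortPermuton

/-! A measure with uniform marginals on the square (`IsPermuton`) has a distribution function that
is 1-Lipschitz in each variable, and its mass on a rectangle is a signed sum of four values of that
function. Pointwise convergence of the distribution functions on the square is therefore
automatically uniform, and it gives every claim about measures. The distribution function of `R` is
`min y (x * exp (y - 1))` (`jointCdf_R`), so the task is to show that the expected number of entries
below `y n` among the first `x n` entries of `runsort π`, divided by `n`, tends to this value.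

Since `runsort` orders positions by run minimum, the positions whose run minimum is below `m` fill
an initial segment, of length N(m) = `lowRunCount π m n`. If N(m) is close to `x n`, then up to the
error |N(m) - x n| the entries to be counted are those of the runs with minimum below `m`
(`abs_runsortCount_sub_lowRunCount_le`).

Read `π` backwards from a position: the run minimum is below `m` iff the values decrease until one
below `m` appears. For independent uniform letters, the probability q(v) of this from the value v is
1 for v < m and (1/n) ∑_{u<v} q(u) otherwise. Hence q(v) = (m/n)(1+1/n)^(v-m) for v ≥ m, and the sum
over v < b is m(1+1/n)^(b-m). With m = sn and b = tn this gives the limit s e^(t-s).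

Two approximations carry this over to permutations. Stopping the reading after `K` steps leaves it
undecided with probability at most 1/K!. Finitely many values of a uniform permutation are dominated
by independent ones up to a factor tending to 1 (`avg_perm_le_avg_fun`); applied to an event and to
its complement, this bounds the first moment from both sides. Applied to two disjoint windows it
bounds the second moment, so N(sn)/n concentrates at s e^(1-s). Taking s with s e^(1-s) = x, the
limit is s e^(y-s) = x e^(y-1) if s ≤ y, and it is y if y ≤ s. -/

namespace RunsortPermuton

open MeasureTheory Set Filter Topology
open scoped ENNReal

/-! ### Permutons and their distribution functions -/

/-- A measure on the plane is a permuton if both its marginals are uniform on `[0, 1]`. -/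
structure IsPermuton (μ : Measure (ℝ × ℝ)) : Prop where
  map_fst : μ.map Prod.fst = volume.restrict (Icc (0 : ℝ) 1)
  map_snd : μ.map Prod.snd = volume.restrict (Icc (0 : ℝ) 1)

/-- The joint distribution function of a measure on the plane. -/
noncomputable def jointCdf (μ : Measure (ℝ × ℝ)) (x y : ℝ) : ℝ := μ.real (Iic x ×ˢ Iic y)

namespace IsPermuton

variable {μ : Measure (ℝ × ℝ)}

theorem isProbabilityMeasure (h : IsPermuton μ) : IsProbabilityMeasure μ := by
  constructor
  have := congrArg (fun ν => ν univ) h.map_fst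
  simpa [Measure.map_apply measurable_fst MeasurableSet.univ] using this

theorem measure_fst_preimage (h : IsPermuton μ) {A : Set ℝ} (hA : MeasurableSet A) :
    μ (A ×ˢ univ) = volume (A ∩ Icc 0 1) := by
  rw [prod_univ, ← Measure.map_apply measurable_fst hA, h.map_fst, Measure.restrict_apply hA]

theorem measure_snd_preimage (h : IsPermuton μ) {A : Set ℝ} (hA : MeasurableSet A) :
    μ (univ ×ˢ A) = volume (A ∩ Icc 0 1) := by
  rw [univ_prod, ← Measure.map_apply measurable_snd hA, h.map_snd, Measure.restrict_apply hA]

theorem real_Ioc_prod_le (h : IsPermuton μ) {a b : ℝ} (hab : a ≤ b) (B : Set ℝ) :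
    μ.real (Ioc a b ×ˢ B) ≤ b - a := by
  have : μ (Ioc a b ×ˢ B) ≤ ENNReal.ofReal (b - a) :=
    calc μ (Ioc a b ×ˢ B) ≤ μ (Ioc a b ×ˢ univ) :=
          measure_mono (prod_mono_right (subset_univ _))
      _ ≤ volume (Ioc a b) := by
          rw [h.measure_fst_preimage measurableSet_Ioc]; exact measure_mono inter_subset_left
      _ = _ := Real.volume_Ioc
  exact ENNReal.toReal_le_of_le_ofReal (by linarith) this

theorem real_prod_Ioc_le (h : IsPermuton μ) {a b : ℝ} (hab : a ≤ b) (A : Set ℝ) :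
    μ.real (A ×ˢ Ioc a b) ≤ b - a := by
  have : μ (A ×ˢ Ioc a b) ≤ ENNReal.ofReal (b - a) :=
    calc μ (A ×ˢ Ioc a b) ≤ μ (univ ×ˢ Ioc a b) :=
          measure_mono (prod_mono_left (subset_univ _))
      _ ≤ volume (Ioc a b) := by
          rw [h.measure_snd_preimage measurableSet_Ioc]; exact measure_mono inter_subset_left
      _ = _ := Real.volume_Ioc
  exact ENNReal.toReal_le_of_le_ofReal (by linarith) this

theorem real_Ioc_prod_Iic (h : IsPermuton μ) {a b : ℝ} (hab : a ≤ b) (y : ℝ) :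
    μ.real (Ioc a b ×ˢ Iic y) = jointCdf μ b y - jointCdf μ a y := by
  have := h.isProbabilityMeasure
  have hu : Iic b ×ˢ Iic y = Iic a ×ˢ Iic y ∪ Ioc a b ×ˢ Iic y := by
    rw [← union_prod, Iic_union_Ioc_eq_Iic hab]
  have hd : Disjoint (Iic a ×ˢ Iic y) (Ioc a b ×ˢ Iic y) := by
    rw [Set.disjoint_prod]; left; exact Iic_disjoint_Ioc le_rfl
  have := measureReal_union (μ := μ) hd (measurableSet_Ioc.prod measurableSet_Iic)
  rw [← hu] at this
  unfold jointCdf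
  linarith

theorem real_Iic_prod_Ioc (h : IsPermuton μ) {a b : ℝ} (hab : a ≤ b) (x : ℝ) :
    μ.real (Iic x ×ˢ Ioc a b) = jointCdf μ x b - jointCdf μ x a := by
  have := h.isProbabilityMeasure
  have hu : Iic x ×ˢ Iic b = Iic x ×ˢ Iic a ∪ Iic x ×ˢ Ioc a b := by
    rw [← prod_union, Iic_union_Ioc_eq_Iic hab]
  have hd : Disjoint (Iic x ×ˢ Iic a) (Iic x ×ˢ Ioc a b) := by
    rw [Set.disjoint_prod]; right; exact Iic_disjoint_Ioc le_rfl
  have := measureReal_union (μ := μ) hd (measurableSet_Iic.prod measurableSet_Ioc)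
  rw [← hu] at this
  unfold jointCdf
  linarith

/-- The difference is the mass of part of a vertical strip, and a uniform marginal bounds that mass
by the width of the strip. -/
theorem abs_jointCdf_sub_le_fst (h : IsPermuton μ) (a b y : ℝ) :
    |jointCdf μ a y - jointCdf μ b y| ≤ |a - b| := by
  wlog hab : a ≤ b generalizing a b
  · rw [abs_sub_comm, abs_sub_comm a]; exact this b a (le_of_not_ge hab)
  have h1 := h.real_Ioc_prod_Iic hab y
  have h2 := h.real_Ioc_prod_le hab (Iic y)
  have h3 : 0 ≤ μ.real (Ioc a b ×ˢ Iic y) := measureReal_nonneg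
  rw [abs_sub_comm, abs_sub_comm a, abs_of_nonneg (by linarith), abs_of_nonneg (by linarith)]
  linarith

theorem abs_jointCdf_sub_le_snd (h : IsPermuton μ) (x a b : ℝ) :
    |jointCdf μ x a - jointCdf μ x b| ≤ |a - b| := by
  wlog hab : a ≤ b generalizing a b
  · rw [abs_sub_comm, abs_sub_comm a]; exact this b a (le_of_not_ge hab)
  have h1 := h.real_Iic_prod_Ioc hab x
  have h2 := h.real_prod_Ioc_le hab (Iic x)
  have h3 : 0 ≤ μ.real (Iic x ×ˢ Ioc a b) := measureReal_nonneg
  rw [abs_sub_comm, abs_sub_comm a, abs_of_nonneg (by linarith), abs_of_nonneg (by linarith)]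
  linarith

theorem abs_jointCdf_sub_le (h : IsPermuton μ) (x y x' y' : ℝ) :
    |jointCdf μ x y - jointCdf μ x' y'| ≤ |x - x'| + |y - y'| := by
  have h1 := h.abs_jointCdf_sub_le_fst x x' y
  have h2 := h.abs_jointCdf_sub_le_snd x' y y'
  have h3 := abs_sub_le (jointCdf μ x y) (jointCdf μ x' y) (jointCdf μ x' y')
  linarith

/-- Inclusion-exclusion computes the half-open rectangle; the missing edges lie on two lines, which
are null because the marginals have no atoms. -/
theorem real_Icc_prod_Icc (h : IsPermuton μ) {x₁ x₂ y₁ y₂ : ℝ} (hx : x₁ ≤ x₂) (hy : y₁ ≤ y₂) :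
    μ.real (Icc x₁ x₂ ×ˢ Icc y₁ y₂) =
      jointCdf μ x₂ y₂ - jointCdf μ x₁ y₂ - jointCdf μ x₂ y₁ + jointCdf μ x₁ y₁ := by
  have := h.isProbabilityMeasure
  have e1 : μ.real (Icc x₁ x₂ ×ˢ Icc y₁ y₂) = μ.real (Ioc x₁ x₂ ×ˢ Ioc y₁ y₂) := by
    apply measureReal_congr
    have hsub : Icc x₁ x₂ ×ˢ Icc y₁ y₂ ⊆
        Ioc x₁ x₂ ×ˢ Ioc y₁ y₂ ∪ ({x₁} ×ˢ univ ∪ univ ×ˢ {y₁}) := by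
      rintro ⟨a, b⟩ ⟨ha, hb⟩
      simp only [mem_union, mem_prod, mem_Ioc, mem_singleton_iff, mem_univ, and_true, true_and,
        mem_Icc] at *
      rcases eq_or_lt_of_le ha.1 with h1 | h1
      · exact Or.inr (Or.inl h1.symm)
      rcases eq_or_lt_of_le hb.1 with h2 | h2
      · exact Or.inr (Or.inr h2.symm)
      exact Or.inl ⟨⟨h1, ha.2⟩, h2, hb.2⟩
    have hnull : μ ({x₁} ×ˢ univ ∪ univ ×ˢ {y₁}) = 0 := by
      refine measure_union_null ?_ ?_
      · rw [h.measure_fst_preimage (measurableSet_singleton _)]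
        exact measure_mono_null inter_subset_left (by simp)
      · rw [h.measure_snd_preimage (measurableSet_singleton _)]
        exact measure_mono_null inter_subset_left (by simp)
    refine Filter.EventuallyLE.antisymm ?_
      (LE.le.eventuallyLE (prod_mono Ioc_subset_Icc_self Ioc_subset_Icc_self))
    rw [ae_le_set]
    refine measure_mono_null ?_ hnull
    rw [sdiff_subset_iff]
    exact hsub
  have hu : Ioc x₁ x₂ ×ˢ Iic y₂ = Ioc x₁ x₂ ×ˢ Iic y₁ ∪ Ioc x₁ x₂ ×ˢ Ioc y₁ y₂ := by
    rw [← prod_union, Iic_union_Ioc_eq_Iic hy]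
  have hd : Disjoint (Ioc x₁ x₂ ×ˢ Iic y₁) (Ioc x₁ x₂ ×ˢ Ioc y₁ y₂) := by
    rw [Set.disjoint_prod]; right; exact Iic_disjoint_Ioc le_rfl
  have := measureReal_union (μ := μ) hd (measurableSet_Ioc.prod measurableSet_Ioc)
  rw [← hu, h.real_Ioc_prod_Iic hx, h.real_Ioc_prod_Iic hx] at this
  rw [e1]
  linarith

/-- Pointwise convergence of the distribution functions of permutons is uniform. -/
theorem eventually_abs_jointCdf_sub_le {μs : ℕ → Measure (ℝ × ℝ)} (hμ : IsPermuton μ)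
    (hμs : ∀ᶠ n in atTop, IsPermuton (μs n))
    (hlim : ∀ x ∈ Icc (0 : ℝ) 1, ∀ y ∈ Icc (0 : ℝ) 1,
      Tendsto (fun n => jointCdf (μs n) x y) atTop (𝓝 (jointCdf μ x y)))
    {ε : ℝ} (hε : 0 < ε) :
    ∀ᶠ n in atTop, ∀ x ∈ Icc (0 : ℝ) 1, ∀ y ∈ Icc (0 : ℝ) 1,
      |jointCdf (μs n) x y - jointCdf μ x y| ≤ ε := by
  -- Rounding both coordinates to the grid of mesh 1/M moves each of the two distribution functions
  -- by at most 2/M, hence the bound 4/M < ε/2.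
  obtain ⟨M, hM⟩ := exists_nat_gt (8 / ε)
  have hM0 : (0 : ℝ) < M := lt_of_le_of_lt (by positivity) hM
  have hM' : 4 / M < ε / 2 := by
    rw [div_lt_iff₀ hε] at hM
    rw [div_lt_iff₀ hM0]
    linarith
  have hgrid : ∀ᶠ n in atTop, ∀ i ∈ Finset.range (M + 1), ∀ j ∈ Finset.range (M + 1),
      |jointCdf (μs n) (i / M) (j / M) - jointCdf μ (i / M) (j / M)| < ε / 2 := by
    rw [eventually_all_finset]
    intro i hi
    rw [eventually_all_finset]
    intro j hj
    have hmem : ∀ k ∈ Finset.range (M + 1), (k : ℝ) / M ∈ Icc (0 : ℝ) 1 := by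
      intro k hk
      refine ⟨by positivity, ?_⟩
      rw [div_le_one hM0]
      exact_mod_cast Nat.lt_succ_iff.mp (Finset.mem_range.mp hk)
    exact (Metric.tendsto_nhds.mp (hlim _ (hmem i hi) _ (hmem j hj))) _ (half_pos hε)
  have key : ∀ x ∈ Icc (0 : ℝ) 1, ∃ i ∈ Finset.range (M + 1), |x - (i : ℝ) / M| ≤ 1 / M := by
    intro x hx
    have h0 : 0 ≤ x * M := mul_nonneg hx.1 hM0.le
    refine ⟨⌊x * M⌋₊, ?_, ?_⟩
    · rw [Finset.mem_range, Nat.lt_succ_iff]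
      refine Nat.floor_le_of_le ?_
      nlinarith [hx.2]
    · have h1 := Nat.floor_le h0
      have h2 := Nat.lt_floor_add_one (x * M)
      have : x - (⌊x * M⌋₊ : ℝ) / M = (x * M - ⌊x * M⌋₊) / M := by field_simp
      rw [this, abs_of_nonneg (div_nonneg (by linarith) hM0.le)]
      gcongr
      linarith
  filter_upwards [hμs, hgrid] with n hn hg x hx y hy
  obtain ⟨i, hi, hxi⟩ := key x hx
  obtain ⟨j, hj, hyj⟩ := key y hy
  have h1 := hn.abs_jointCdf_sub_le x y (i / M) (j / M)
  have h2 := hμ.abs_jointCdf_sub_le x y (i / M) (j / M)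
  have h3 := hg i hi j hj
  have h4 : 4 / (M : ℝ) = 4 * (1 / M) := by ring
  rw [abs_le] at h1 h2 ⊢
  rw [abs_lt] at h3
  constructor <;> linarith [h1.1, h1.2, h2.1, h2.2, h3.1, h3.2]

end IsPermuton

/-! ### Run minima and the order of positions in `runsort` -/

section RunMin

variable {n : ℕ} (π : Equiv.Perm (Fin n))

theorem mem_run {i j : Fin n} :
    j ∈ run π i ↔ ∀ a ∈ Finset.uIcc i j, ∀ b ∈ Finset.uIcc i j, a < b → π a < π b := by
  simp [run]

theorem runMin_le (i : Fin n) : runMin π i ≤ π i :=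
  Finset.inf'_le _ (self_mem_run π i)

/-- A descent just before `i` makes `i` the first position of its run, and a run increases. Together
with the ascent case this gives the backward recursion that `chainIndicator` encodes. -/
theorem runMin_eq_of_descent {i j : Fin n} (hij : (j : ℕ) + 1 = i) (h : π i < π j) :
    runMin π i = π i := by
  refine le_antisymm (runMin_le π i) ?_
  refine Finset.le_inf' _ _ fun k hk => ?_
  rw [mem_run] at hk
  have hik : i ≤ k := by
    by_contra! hlt
    have hj : j ∈ Finset.uIcc i k := by
      rw [Finset.uIcc_of_ge hlt.le, Finset.mem_Icc, Fin.le_def, Fin.le_def]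
      rw [Fin.lt_def] at hlt
      omega
    have := hk j hj i Finset.left_mem_uIcc (by rw [Fin.lt_def]; omega)
    exact absurd this (not_lt.mpr h.le)
  rcases eq_or_lt_of_le hik with rfl | hlt
  · exact le_rfl
  · exact (hk i Finset.left_mem_uIcc k Finset.right_mem_uIcc hlt).le

theorem runMin_eq_of_ascent {i j : Fin n} (hij : (j : ℕ) + 1 = i) (h : π j < π i) :
    runMin π i = runMin π j := by
  have hrun : run π i = run π j := by
    ext k
    rw [mem_run, mem_run]
    rcases le_or_gt i k with hk | hk
    · have hjk : j ≤ k := by rw [Fin.le_def] at hk ⊢; omega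
      rw [Finset.uIcc_of_le hk, Finset.uIcc_of_le hjk]
      constructor
      · intro H a ha b hb hab
        rw [Finset.mem_Icc] at ha hb
        have hb' : b ∈ Finset.Icc i k := by
          rw [Finset.mem_Icc]; refine ⟨?_, hb.2⟩
          simp only [Fin.le_def, Fin.lt_def] at *; omega
        by_cases haj : a = j
        · rw [haj]
          rcases eq_or_lt_of_le (Finset.mem_Icc.mp hb').1 with rfl | hib
          · exact h
          · exact h.trans (H i (Finset.left_mem_Icc.mpr hk) b hb' hib)
        · refine H a ?_ b hb' hab
          rw [Finset.mem_Icc]; refine ⟨?_, ha.2⟩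
          rw [Fin.ext_iff] at haj
          simp only [Fin.le_def, Fin.lt_def] at *; omega
      · intro H a ha b hb hab
        rw [Finset.mem_Icc] at ha hb
        refine H a ?_ b ?_ hab <;> rw [Finset.mem_Icc] <;>
          simp only [Fin.le_def, Fin.lt_def] at * <;> omega
    · have hkj : k ≤ j := by rw [Fin.lt_def] at hk; rw [Fin.le_def]; omega
      rw [Finset.uIcc_of_ge hk.le, Finset.uIcc_of_ge hkj]
      constructor
      · intro H a ha b hb hab
        rw [Finset.mem_Icc] at ha hb
        refine H a ?_ b ?_ hab <;> rw [Finset.mem_Icc] <;>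
          simp only [Fin.le_def, Fin.lt_def] at * <;> omega
      · intro H a ha b hb hab
        rw [Finset.mem_Icc] at ha hb
        have ha' : a ∈ Finset.Icc k j := by
          rw [Finset.mem_Icc]; refine ⟨ha.1, ?_⟩
          simp only [Fin.le_def, Fin.lt_def] at *; omega
        by_cases hbi : b = i
        · rw [hbi]
          rcases eq_or_lt_of_le (Finset.mem_Icc.mp ha').2 with rfl | haj
          · exact h
          · exact (H a ha' j (Finset.right_mem_Icc.mpr hkj) haj).trans h
        · refine H a ha' b ?_ hab
          rw [Finset.mem_Icc]; refine ⟨hb.1, ?_⟩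
          rw [Fin.ext_iff] at hbi
          simp only [Fin.le_def, Fin.lt_def] at *; omega
  unfold runMin
  simp only [hrun]

/-- The number of positions `k` with `runMin π k < m` and `π k < b`. -/
def lowRunCount (m b : ℕ) : ℕ :=
  (Finset.univ.filter fun k : Fin n => (runMin π k : ℕ) < m ∧ (π k : ℕ) < b).card

/-- The number of positions `i < a` whose entry in `runsort π` is smaller than `b`. -/
def runsortCount (a b : ℕ) : ℕ :=
  (Finset.univ.filter fun i : Fin n => (i : ℕ) < a ∧ (runsort π i : ℕ) < b).card

theorem card_filter_perm_lt (σ : Equiv.Perm (Fin n)) {b : ℕ} (hb : b ≤ n) :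
    (Finset.univ.filter fun k : Fin n => (σ k : ℕ) < b).card = b := by
  rw [Finset.card_equiv σ (t := Finset.univ.filter fun k : Fin n => (k : ℕ) < b) (by simp)]
  rw [Fin.card_filter_val_lt, min_eq_right hb]

theorem lowRunCount_of_le {m b : ℕ} (hbm : b ≤ m) (hb : b ≤ n) : lowRunCount π m b = b := by
  refine Eq.trans ?_ (card_filter_perm_lt π hb)
  unfold lowRunCount
  congr 1
  ext k
  simp only [Finset.mem_filter, Finset.mem_univ, true_and, and_iff_right_iff_imp]
  intro hk
  have := Fin.le_def.mp (runMin_le π k)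
  omega

/-- The key is monotone along the sorted order, so the indices with key below `m` form an initial
segment, determined by its cardinality. With `b = n` the second condition in `lowRunCount` is
vacuous. -/
theorem runMin_sort_lt_iff (m : ℕ) (i : Fin n) :
    (runMin π (Tuple.sort (runMin π) i) : ℕ) < m ↔ (i : ℕ) < lowRunCount π m n := by
  set σ := Tuple.sort (runMin π) with hσ
  have hmono : Monotone (runMin π ∘ σ) := Tuple.monotone_sort (runMin π)
  have hcard : lowRunCount π m n =
      (Finset.univ.filter fun i : Fin n => (runMin π (σ i) : ℕ) < m).card := by
    unfold lowRunCount
    symm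
    exact Finset.card_equiv σ (by simp)
  rw [hcard]
  constructor
  · intro h
    have hsub : Finset.univ.filter (fun k : Fin n => (k : ℕ) < i + 1) ⊆
        Finset.univ.filter fun i : Fin n => (runMin π (σ i) : ℕ) < m := by
      intro k hk
      simp only [Finset.mem_filter, Finset.mem_univ, true_and] at hk ⊢
      have := Fin.le_def.mp (hmono (Fin.le_def.mpr (Nat.lt_succ_iff.mp hk)))
      simp only [Function.comp_apply] at this
      omega
    have := Finset.card_le_card hsub
    rw [Fin.card_filter_val_lt] at this
    have := i.2
    omega
  · intro h
    by_contra! hm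
    have hsub : (Finset.univ.filter fun i : Fin n => (runMin π (σ i) : ℕ) < m) ⊆
        Finset.univ.filter (fun k : Fin n => (k : ℕ) < i) := by
      intro k hk
      simp only [Finset.mem_filter, Finset.mem_univ, true_and] at hk ⊢
      by_contra! hik
      have := Fin.le_def.mp (hmono (Fin.le_def.mpr hik))
      simp only [Function.comp_apply] at this
      omega
    have := Finset.card_le_card hsub
    rw [Fin.card_filter_val_lt] at this
    omega

theorem lowRunCount_eq_runsortCount (m b : ℕ) :
    lowRunCount π m b = runsortCount π (lowRunCount π m n) b := by
  symm
  refine Finset.card_equiv (Tuple.sort (runMin π)) fun i => ?_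
  simp only [Finset.mem_filter, Finset.mem_univ, true_and, ← runMin_sort_lt_iff, runsort,
    Equiv.Perm.mul_apply]

theorem runsortCount_mono {a a' : ℕ} (h : a ≤ a') (b : ℕ) :
    runsortCount π a b ≤ runsortCount π a' b := by
  refine Finset.card_le_card fun i hi => ?_
  simp only [Finset.mem_filter, Finset.mem_univ, true_and] at hi ⊢
  omega

theorem runsortCount_le_add {a a' : ℕ} (b : ℕ) :
    runsortCount π a' b ≤ runsortCount π a b + (a' - a) := by
  have hsub : (Finset.univ.filter fun i : Fin n => (i : ℕ) < a' ∧ (runsort π i : ℕ) < b) ⊆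
      (Finset.univ.filter fun i : Fin n => (i : ℕ) < a ∧ (runsort π i : ℕ) < b) ∪
        Finset.univ.filter fun i : Fin n => (i : ℕ) ∈ Finset.Ico a a' := by
    intro i hi
    simp only [Finset.mem_filter, Finset.mem_univ, true_and, Finset.mem_union,
      Finset.mem_Ico] at hi ⊢
    omega
  refine (Finset.card_le_card hsub).trans ((Finset.card_union_le _ _).trans ?_)
  refine Nat.add_le_add_left ?_ _
  rw [← Nat.card_Ico]
  exact Finset.card_le_card_of_injOn (fun i => (i : ℕ)) (fun i hi => by simpa using hi)
    (fun _ _ _ _ h => Fin.ext h)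

/-- The sorted order lists the positions with `runMin π k < m` first. -/
theorem abs_runsortCount_sub_lowRunCount_le (a m b : ℕ) :
    |(runsortCount π a b : ℝ) - lowRunCount π m b| ≤ |(lowRunCount π m n : ℝ) - a| := by
  rw [lowRunCount_eq_runsortCount π m b]
  generalize lowRunCount π m n = N
  rcases le_total a N with h | h
  · have h1 := runsortCount_mono π h b
    have h2 := runsortCount_le_add π (a := a) (a' := N) b
    rw [abs_sub_comm, abs_of_nonneg, abs_of_nonneg]
    · rw [← Nat.cast_sub h1, ← Nat.cast_sub h]; exact_mod_cast (by omega)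
    · rw [sub_nonneg]; exact_mod_cast h
    · rw [sub_nonneg]; exact_mod_cast h1
  · have h1 := runsortCount_mono π h b
    have h2 := runsortCount_le_add π (a := N) (a' := a) b
    rw [abs_sub_comm (N : ℝ), abs_of_nonneg, abs_of_nonneg]
    · rw [← Nat.cast_sub h1, ← Nat.cast_sub h]; exact_mod_cast (by omega)
    · rw [sub_nonneg]; exact_mod_cast h
    · rw [sub_nonneg]; exact_mod_cast h1

end RunMin

/-! ### The measures of permutations and their expectation -/

section Gamma

variable {n : ℕ}

/-- The `i`-th of the `n` intervals of length `1/n` that make up `[0, 1)`. -/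
def cell (n i : ℕ) : Set ℝ := Ico ((i : ℝ) / n) (((i : ℝ) + 1) / n)

theorem measurableSet_cell (n i : ℕ) : MeasurableSet (cell n i) := measurableSet_Ico

theorem mem_cell_iff (hn : 0 < n) {i : ℕ} {x : ℝ} :
    x ∈ cell n i ↔ 0 ≤ x ∧ ⌊x * n⌋₊ = i := by
  have hn' : (0 : ℝ) < n := by exact_mod_cast hn
  rw [cell, mem_Ico, div_le_iff₀ hn', lt_div_iff₀ hn']
  constructor
  · rintro ⟨h1, h2⟩
    have h0 : 0 ≤ x * n := le_trans (by positivity) h1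
    exact ⟨nonneg_of_mul_nonneg_left h0 hn', (Nat.floor_eq_iff h0).mpr ⟨h1, h2⟩⟩
  · rintro ⟨h0, h1⟩
    exact (Nat.floor_eq_iff (by positivity)).mp h1

theorem disjoint_cell (hn : 0 < n) {i j : ℕ} (hij : i ≠ j) : Disjoint (cell n i) (cell n j) := by
  rw [Set.disjoint_left]
  intro x hi hj
  exact hij (((mem_cell_iff hn).mp hi).2.symm.trans ((mem_cell_iff hn).mp hj).2)

theorem iUnion_cell (hn : 0 < n) : ⋃ i : Fin n, cell n i = Ico 0 1 := by
  have hn' : (0 : ℝ) < n := by exact_mod_cast hn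
  ext x
  simp only [mem_iUnion, mem_cell_iff hn, mem_Ico]
  constructor
  · rintro ⟨i, h0, h1⟩
    refine ⟨h0, ?_⟩
    have h2 : ⌊x * n⌋₊ < n := h1 ▸ i.2
    rw [Nat.floor_lt (by positivity)] at h2
    nlinarith
  · rintro ⟨h0, h1⟩
    have : ⌊x * n⌋₊ < n := by
      rw [Nat.floor_lt (by positivity)]
      nlinarith
    exact ⟨⟨_, this⟩, h0, rfl⟩

theorem volume_cell (hn : 0 < n) (i : ℕ) : volume (cell n i) = (n : ℝ≥0∞)⁻¹ := by
  have hn' : (0 : ℝ) < n := by exact_mod_cast hn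
  rw [cell, Real.volume_Ico, ← sub_div, add_sub_cancel_left, one_div,
    ENNReal.ofReal_inv_of_pos hn', ENNReal.ofReal_natCast]

theorem volume_Iic_inter_cell (hn : 0 < n) (a i : ℕ) :
    volume (Iic ((a : ℝ) / n) ∩ cell n i) = if i < a then (n : ℝ≥0∞)⁻¹ else 0 := by
  have hn' : (0 : ℝ) < n := by exact_mod_cast hn
  split_ifs with h
  · rw [inter_eq_self_of_subset_right, volume_cell hn]
    intro x hx
    refine hx.2.le.trans ?_
    gcongr
    exact_mod_cast h
  -- For `i = a` the closed half-line touches the cell in its left endpoint, which is null.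
  · refine measure_mono_null (t := {(a : ℝ) / n}) ?_ (by simp)
    rintro x ⟨h1, h2⟩
    refine le_antisymm h1 (le_trans ?_ h2.1)
    gcongr
    exact_mod_cast not_lt.mp h

/-- The cells of distinct columns are disjoint; as a sum of product measures, `gamma π` has
marginals and quadrant masses that factor cell by cell. -/
theorem gamma_eq_sum (hn : 0 < n) (π : Equiv.Perm (Fin n)) :
    gamma π = (n : ℝ≥0∞) •
      ∑ i : Fin n, (volume.restrict (cell n i)).prod (volume.restrict (cell n (π i))) := by
  have hmeas : ∀ i : Fin n, MeasurableSet (cell n i ×ˢ cell n (π i)) := fun i =>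
    (measurableSet_cell _ _).prod (measurableSet_cell _ _)
  have h : gamma π = volume.withDensity
      ((⋃ i : Fin n, cell n i ×ˢ cell n (π i)).indicator fun _ => (n : ℝ≥0∞)) := rfl
  rw [h, withDensity_indicator (MeasurableSet.iUnion hmeas), withDensity_const,
    Measure.restrict_iUnion _ hmeas, Measure.sum_fintype]
  · simp only [Measure.prod_restrict, Measure.volume_eq_prod]
  · intro i j hij
    rw [Function.onFun, Set.disjoint_prod]
    left
    exact disjoint_cell hn (fun h => hij (Fin.ext h))

theorem sum_restrict_cell (hn : 0 < n) :
    ∑ i : Fin n, (volume : Measure ℝ).restrict (cell n i) = volume.restrict (Icc 0 1) := by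
  rw [← restrict_Ico_eq_restrict_Icc, ← iUnion_cell hn, Measure.restrict_iUnion,
    Measure.sum_fintype]
  · intro i j hij
    exact disjoint_cell hn (fun h => hij (Fin.ext h))
  · exact fun i => measurableSet_cell _ _

theorem isPermuton_gamma (hn : 0 < n) (π : Equiv.Perm (Fin n)) : IsPermuton (gamma π) := by
  have hn0 : (n : ℝ≥0∞) ≠ 0 := by exact_mod_cast hn.ne'
  have hcancel : ∀ μ : Measure ℝ, (n : ℝ≥0∞) • (n : ℝ≥0∞)⁻¹ • μ = μ := fun μ => by
    rw [smul_smul, ENNReal.mul_inv_cancel hn0 (ENNReal.natCast_ne_top n), one_smul]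
  constructor
  · rw [gamma_eq_sum hn, Measure.map_smul, ← Measure.mapₗ_apply_of_measurable measurable_fst,
      map_sum]
    simp only [Measure.mapₗ_apply_of_measurable measurable_fst, Measure.map_fst_prod,
      Measure.restrict_apply_univ, volume_cell hn]
    rw [← Finset.smul_sum, hcancel, sum_restrict_cell hn]
  · rw [gamma_eq_sum hn, Measure.map_smul, ← Measure.mapₗ_apply_of_measurable measurable_snd,
      map_sum]
    simp only [Measure.mapₗ_apply_of_measurable measurable_snd, Measure.map_snd_prod,
      Measure.restrict_apply_univ, volume_cell hn]
    rw [← Finset.smul_sum, hcancel, ← sum_restrict_cell hn]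
    exact Equiv.sum_comp π fun i : Fin n => (volume : Measure ℝ).restrict (cell n i)

theorem gamma_Iic_prod_Iic (hn : 0 < n) (π : Equiv.Perm (Fin n)) (a b : ℕ) :
    gamma π (Iic ((a : ℝ) / n) ×ˢ Iic ((b : ℝ) / n)) =
      ((Finset.univ.filter fun i : Fin n => (i : ℕ) < a ∧ (π i : ℕ) < b).card : ℝ≥0∞) / n := by
  have hn0 : (n : ℝ≥0∞) ≠ 0 := by exact_mod_cast hn.ne'
  have hterm : ∀ i : Fin n,
      (if (i : ℕ) < a then (n : ℝ≥0∞)⁻¹ else 0) * (if (π i : ℕ) < b then (n : ℝ≥0∞)⁻¹ else 0) =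
      if (i : ℕ) < a ∧ (π i : ℕ) < b then (n : ℝ≥0∞)⁻¹ * (n : ℝ≥0∞)⁻¹ else 0 := by
    intro i
    split_ifs <;> simp_all
  rw [gamma_eq_sum hn, Measure.smul_apply, Measure.finsetSum_apply]
  simp only [Measure.prod_prod, Measure.restrict_apply measurableSet_Iic,
    volume_Iic_inter_cell hn, hterm]
  rw [← Finset.sum_filter, Finset.sum_const, smul_eq_mul, nsmul_eq_mul, div_eq_mul_inv,
    mul_left_comm, ← mul_assoc (n : ℝ≥0∞), ENNReal.mul_inv_cancel hn0 (ENNReal.natCast_ne_top n),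
    one_mul]

theorem isPermuton_meanMeasure (hn : 0 < n) : IsPermuton (meanMeasure n) := by
  have hf0 : (n.factorial : ℝ≥0∞) ≠ 0 := by exact_mod_cast n.factorial_ne_zero
  have hcancel : ∀ μ : Measure ℝ, (n.factorial : ℝ≥0∞)⁻¹ • n.factorial • μ = μ := fun μ => by
    rw [← Nat.cast_smul_eq_nsmul ℝ≥0∞, smul_smul,
      ENNReal.inv_mul_cancel hf0 (ENNReal.natCast_ne_top _), one_smul]
  constructor
  · rw [meanMeasure, Measure.map_smul, ← Measure.mapₗ_apply_of_measurable measurable_fst, map_sum]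
    simp only [Measure.mapₗ_apply_of_measurable measurable_fst, (isPermuton_gamma hn _).map_fst,
      Finset.sum_const, Finset.card_univ, Fintype.card_perm, Fintype.card_fin, hcancel]
  · rw [meanMeasure, Measure.map_smul, ← Measure.mapₗ_apply_of_measurable measurable_snd, map_sum]
    simp only [Measure.mapₗ_apply_of_measurable measurable_snd, (isPermuton_gamma hn _).map_snd,
      Finset.sum_const, Finset.card_univ, Fintype.card_perm, Fintype.card_fin, hcancel]

/-- The expectation of a functional of a uniformly random permutation. -/
noncomputable def permAvg (n : ℕ) (f : Equiv.Perm (Fin n) → ℝ) : ℝ :=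
  (∑ π, f π) / n.factorial

/-- At grid points no cell is cut in its interior, so the identity is exact. -/
theorem jointCdf_meanMeasure (hn : 0 < n) (a b : ℕ) :
    jointCdf (meanMeasure n) (a / n) (b / n) = permAvg n fun π => (runsortCount π a b : ℝ) / n := by
  have hn0 : (n : ℝ≥0∞) ≠ 0 := by exact_mod_cast hn.ne'
  rw [jointCdf, Measure.real, meanMeasure, Measure.smul_apply, Measure.finsetSum_apply]
  simp only [gamma_Iic_prod_Iic hn]
  rw [smul_eq_mul, ENNReal.toReal_mul, ENNReal.toReal_sum]
  · simp only [ENNReal.toReal_inv, ENNReal.toReal_div, ENNReal.toReal_natCast]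
    rw [permAvg, div_eq_inv_mul]
    rfl
  · intro π _
    exact ENNReal.div_ne_top (ENNReal.natCast_ne_top _) hn0

end Gamma

/-! ### Comparison of a uniform permutation with independent letters -/

section Injections

open Finset

/-- Any two embeddings of a finite type into `Fin n` differ by a permutation of `Fin n`. -/
theorem exists_perm_comp_embedding_eq {n : ℕ} {ι : Type*} [Fintype ι] (v w : ι ↪ Fin n) :
    ∃ τ : Equiv.Perm (Fin n), ∀ i, τ (v i) = w i := by
  classical
  let e : {x // x ∈ Set.range v} ≃ {x // x ∈ Set.range w} :=
    (Equiv.ofInjective v v.injective).symm.trans (Equiv.ofInjective w w.injective)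
  refine ⟨e.extendSubtype, fun i => ?_⟩
  rw [Equiv.extendSubtype_apply_of_mem e (v i) ⟨i, rfl⟩]
  have : (Equiv.ofInjective v v.injective).symm ⟨v i, i, rfl⟩ = i :=
    Equiv.ofInjective_symm_apply v.injective i
  simp [e, this]

/-- Permutations act transitively on embeddings, so all fibres of `π ↦ π ∘ e` have the same size. -/
theorem sum_perm_comp_embedding {n : ℕ} {ι : Type*} [Fintype ι] [DecidableEq ι] (e : ι ↪ Fin n)
    (φ : (ι → Fin n) → ℝ) :
    (n.descFactorial (Fintype.card ι) : ℝ) * ∑ π : Equiv.Perm (Fin n), φ (π ∘ e) =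
      n.factorial * ∑ w : ι ↪ Fin n, φ w := by
  classical
  let c : (ι ↪ Fin n) → ℕ := fun w =>
    (univ.filter fun π : Equiv.Perm (Fin n) => e.trans π.toEmbedding = w).card
  have hc : ∀ w, c w = c e := by
    intro w
    obtain ⟨τ, hτ⟩ := exists_perm_comp_embedding_eq w e
    refine Finset.card_bij (fun π _ => τ * π) ?_ ?_ ?_
    · intro π hπ
      simp only [mem_filter, Finset.mem_univ, true_and] at hπ ⊢
      ext i
      have := DFunLike.congr_fun hπ i
      simp only [Function.Embedding.trans_apply, Equiv.coe_toEmbedding] at this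
      simp [this, hτ]
    · intro π _ π' _ h
      exact mul_left_cancel h
    · intro π hπ
      simp only [mem_filter, Finset.mem_univ, true_and] at hπ
      refine ⟨τ⁻¹ * π, ?_, by simp⟩
      simp only [mem_filter, Finset.mem_univ, true_and]
      ext i
      have := DFunLike.congr_fun hπ i
      simp only [Function.Embedding.trans_apply, Equiv.coe_toEmbedding] at this
      have h2 : τ⁻¹ (π (e i)) = w i := by
        rw [this]; exact (Equiv.symm_apply_eq τ).mpr (hτ i).symm
      simpa using congrArg Fin.val h2
  have hsum : ∀ ψ : (ι → Fin n) → ℝ,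
      ∑ π : Equiv.Perm (Fin n), ψ (π ∘ e) = c e * ∑ w : ι ↪ Fin n, ψ w := by
    intro ψ
    rw [← Finset.sum_fiberwise (s := univ)
      (g := fun π : Equiv.Perm (Fin n) => e.trans π.toEmbedding), mul_sum]
    refine sum_congr rfl fun w _ => ?_
    rw [← hc w]
    simp only [c]
    rw [← nsmul_eq_mul]
    refine sum_eq_card_nsmul fun π hπ => ?_
    rw [mem_filter] at hπ
    rw [← hπ.2]
    rfl
  -- The constant function 1 reveals the common fibre size: n! = `c e` times the number of
  -- embeddings.
  have hone := hsum fun _ => 1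
  simp only [sum_const, card_univ, Fintype.card_perm, Fintype.card_fin, nsmul_eq_mul, mul_one,
    Fintype.card_embedding_eq] at hone
  rw [hsum, hone]
  ring

/-- Restricted to finitely many positions, a uniform permutation is dominated by independent
uniform values, up to the factor `n ^ s / (n)_s`. -/
theorem avg_perm_le_avg_fun {n : ℕ} {ι : Type*} [Fintype ι] [DecidableEq ι] (e : ι ↪ Fin n)
    {φ : (ι → Fin n) → ℝ} (hφ : ∀ w, 0 ≤ φ w) :
    permAvg n (fun π => φ (π ∘ e)) ≤
      ((n : ℝ) ^ Fintype.card ι / n.descFactorial (Fintype.card ι)) *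
        ((∑ w : ι → Fin n, φ w) / (n : ℝ) ^ Fintype.card ι) := by
  have hs : Fintype.card ι ≤ n := by simpa using Fintype.card_le_of_embedding e
  have hd : (0 : ℝ) < n.descFactorial (Fintype.card ι) := by
    exact_mod_cast Nat.pos_of_ne_zero (by rw [Ne, Nat.descFactorial_eq_zero_iff_lt]; omega)
  have hf : (0 : ℝ) < n.factorial := by exact_mod_cast n.factorial_pos
  -- Passing from injective words to all words only adds nonnegative terms; this is why the
  -- comparison is one-sided.
  have hle : ∑ w : ι ↪ Fin n, φ w ≤ ∑ w : ι → Fin n, φ w := by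
    rw [← Finset.sum_image (s := univ) (g := fun w : ι ↪ Fin n => (w : ι → Fin n))
      (fun _ _ _ _ h => DFunLike.coe_injective h)]
    exact sum_le_sum_of_subset_of_nonneg (subset_univ _) fun w _ _ => hφ w
  have hmain := sum_perm_comp_embedding e φ
  have hpow : (n : ℝ) ^ Fintype.card ι ≠ 0 := by
    rcases Nat.eq_zero_or_pos n with h0 | h0
    · have : Fintype.card ι = 0 := by omega
      simp [this]
    · positivity
  have : (∑ π : Equiv.Perm (Fin n), φ (π ∘ e)) / n.factorial =
      (∑ w : ι ↪ Fin n, φ w) / n.descFactorial (Fintype.card ι) := by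
    rw [div_eq_div_iff hf.ne' hd.ne']
    linarith
  rw [permAvg, this, div_mul_div_comm, mul_comm ((n : ℝ) ^ _), mul_div_mul_right _ _ hpow]
  gcongr

end Injections

/-! ### Backward reading of a run in a word of independent letters -/

section Chains

variable {n : ℕ}

/-- `chainIndicator m c K w` is `1` if the word `w` of length `K + 1` decreases from its start until
it meets a letter smaller than `m`; it is `0` if an ascent occurs before, and `c` if neither happens
in the whole word. -/
def chainIndicator (m : ℕ) (c : ℝ) : (K : ℕ) → (Fin (K + 1) → Fin n) → ℝ
  | 0, w => if (w 0 : ℕ) < m then 1 else c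
  | K + 1, w =>
    if (w 0 : ℕ) < m then 1 else if w 1 < w 0 then chainIndicator m c K (Fin.tail w) else 0

theorem chainIndicator_nonneg (m : ℕ) {c : ℝ} (hc : 0 ≤ c) (K : ℕ) (w : Fin (K + 1) → Fin n) :
    0 ≤ chainIndicator m c K w := by
  induction K with
  | zero => unfold chainIndicator; split_ifs <;> linarith
  | succ K ih =>
    unfold chainIndicator
    split_ifs
    · exact zero_le_one
    · exact ih _
    · exact le_rfl

theorem chainIndicator_le_one (m : ℕ) {c : ℝ} (hc : c ≤ 1) (K : ℕ) (w : Fin (K + 1) → Fin n) :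
    chainIndicator m c K w ≤ 1 := by
  induction K with
  | zero => unfold chainIndicator; split_ifs <;> linarith
  | succ K ih =>
    unfold chainIndicator
    split_ifs
    · exact le_rfl
    · exact ih _
    · exact zero_le_one

/-- The positions `i, i - 1, …, i - K`. -/
def window (K : ℕ) (i : Fin n) (j : Fin (K + 1)) : Fin n := ⟨i - j, by omega⟩

/-- Subtraction of naturals truncates at 0, so the window is a genuine set of `K + 1` positions only
at distance at least `K` from the left end. -/
theorem window_injective {K : ℕ} {i : Fin n} (hi : K ≤ i) : Function.Injective (window K i) := by
  intro j j' h
  simp only [window, Fin.mk.injEq] at h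
  ext
  omega

theorem window_zero_right (K : ℕ) (i : Fin n) : window K i 0 = i := by
  ext; simp [window]

theorem tail_window (K : ℕ) (i : Fin n) :
    Fin.tail (window (K + 1) i) = window K (window (K + 1) i 1) := by
  ext j
  simp only [Fin.tail, window, Fin.val_succ, Fin.val_one]
  omega

/-- Going backwards, an ascent of `π` stays in the run and a descent ends it. The reading decides
the event unless it survives all `K` steps; counting the undecided case as 0 or as 1 gives the two
bounds. -/
theorem chainIndicator_window_bounds (π : Equiv.Perm (Fin n)) (m K : ℕ) (i : Fin n)
    (hi : K ≤ i) :
    chainIndicator m 0 K (π ∘ window K i) ≤ (if (runMin π i : ℕ) < m then 1 else 0) ∧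
      (if (runMin π i : ℕ) < m then (1 : ℝ) else 0) ≤ chainIndicator m 1 K (π ∘ window K i) := by
  have hle := Fin.le_def.mp (runMin_le π i)
  induction K generalizing i with
  | zero =>
    simp only [chainIndicator, Function.comp_apply, window_zero_right]
    constructor
    · split_ifs
      · exact le_rfl
      · omega
      · exact zero_le_one
      · exact le_rfl
    · split_ifs <;> norm_num
  | succ K ih =>
    set i' := window (K + 1) i 1 with hi'
    have hi'v : (i' : ℕ) + 1 = i := by simp [i', window]; omega
    have htail : Fin.tail (π ∘ window (K + 1) i) = π ∘ window K i' := by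
      rw [hi', ← tail_window]; rfl
    simp only [chainIndicator, htail, Function.comp_apply, window_zero_right, ← hi']
    by_cases h0 : (π i : ℕ) < m
    · have : (runMin π i : ℕ) < m := by omega
      simp [h0, this]
    · rcases lt_or_ge (π i') (π i) with h1 | h1
      · rw [runMin_eq_of_ascent π hi'v h1]
        simp only [h0, h1, if_true, if_false]
        exact ih i' (by omega) (Fin.le_def.mp (runMin_le π i'))
      · have hne : π i ≠ π i' := fun h => by
          have := π.injective h
          rw [Fin.ext_iff] at this
          omega
        rw [runMin_eq_of_descent π hi'v (lt_of_le_of_ne h1 hne)]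
        simp [h0, not_lt.mpr h1]

/-- The average of `chainIndicator m c K` over the words with first letter `v`. -/
noncomputable def chainAvg (m : ℕ) (c : ℝ) (K : ℕ) (v : Fin n) : ℝ :=
  (∑ w : Fin K → Fin n, chainIndicator m c K (Fin.cons v w)) / (n : ℝ) ^ K

theorem chainAvg_zero (m : ℕ) (c : ℝ) (v : Fin n) :
    chainAvg m c 0 v = if (v : ℕ) < m then 1 else c := by
  simp [chainAvg, chainIndicator]

theorem sum_word_succ (K : ℕ) (φ : (Fin (K + 1) → Fin n) → ℝ) :
    ∑ w, φ w = ∑ v : Fin n, ∑ w : Fin K → Fin n, φ (Fin.cons v w) := by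
  rw [← Fintype.sum_prod_type', ← (Fin.consEquiv fun _ : Fin (K + 1) => Fin n).sum_comp]
  rfl

/-- Condition on the second letter: only some u < v continues the reading, and what remains is a
word that starts at u. -/
theorem chainAvg_succ (m : ℕ) (c : ℝ) (K : ℕ) (v : Fin n) :
    chainAvg m c (K + 1) v =
      if (v : ℕ) < m then 1
      else (∑ u : Fin n, if (u : ℕ) < v then chainAvg m c K u else 0) / n := by
  have hn : (n : ℝ) ≠ 0 := by exact_mod_cast (Fin.pos v).ne'
  have hstep : ∀ w : Fin (K + 1) → Fin n, chainIndicator m c (K + 1) (Fin.cons v w) =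
      if (v : ℕ) < m then 1 else if w 0 < v then chainIndicator m c K w else 0 := by
    intro w
    simp only [chainIndicator, Fin.cons_zero, Fin.tail_cons]
    rfl
  unfold chainAvg
  simp only [hstep]
  split_ifs with h
  · simp [hn]
  · rw [sum_word_succ, pow_succ, ← div_div]
    congr 1
    rw [Finset.sum_div]
    refine Finset.sum_congr rfl fun u _ => ?_
    simp only [Fin.cons_zero, Fin.lt_def]
    split_ifs <;> simp

theorem sum_fin_ite_lt {b : ℕ} (hb : b ≤ n) (F : ℕ → ℝ) :
    (∑ u : Fin n, if (u : ℕ) < b then F u else 0) = ∑ u ∈ Finset.range b, F u := by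
  rw [Fin.sum_univ_eq_sum_range (fun u => if u < b then F u else 0), ← Finset.sum_filter]
  refine Finset.sum_congr ?_ fun _ _ => rfl
  ext u
  simp only [Finset.mem_filter, Finset.mem_range]
  omega

/-- The probability that the run of a letter with value `v` has its minimum below `m`, in an
infinite sequence of independent uniform letters `0, …, n - 1`. -/
noncomputable def chainProb (n m v : ℕ) : ℝ :=
  if v < m then 1 else (m : ℝ) / n * (1 + 1 / n) ^ (v - m)

/-- From `m` on, each new term is 1/n times the sum so far, so every step multiplies the sum by 1 +
1/n: a discrete form of F' = F. -/
theorem sum_chainProb (hn : 0 < n) {m b : ℕ} (hmb : m ≤ b) :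
    ∑ u ∈ Finset.range b, chainProb n m u = m * (1 + 1 / n) ^ (b - m) := by
  have hn' : (n : ℝ) ≠ 0 := by exact_mod_cast hn.ne'
  induction b, hmb using Nat.le_induction with
  | base =>
    rw [Finset.sum_congr rfl (g := fun _ => (1 : ℝ))]
    · simp
    · intro u hu
      simp [chainProb, Finset.mem_range.mp hu]
  | succ b hb ih =>
    rw [Finset.sum_range_succ, ih, chainProb, if_neg (by omega), Nat.succ_sub hb, pow_succ]
    field_simp

/-- This is the recursion of `chainAvg_succ` with the truncation removed. -/
theorem chainProb_eq (hn : 0 < n) (m v : ℕ) :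
    chainProb n m v =
      if v < m then 1 else (∑ u ∈ Finset.range v, chainProb n m u) / n := by
  split_ifs with h
  · simp [chainProb, h]
  · rw [sum_chainProb hn (not_lt.mp h), chainProb, if_neg h]
    ring

theorem chainProb_nonneg (n m v : ℕ) : 0 ≤ chainProb n m v := by
  unfold chainProb
  split_ifs <;> positivity

theorem chainProb_le_one (m : ℕ) {v : ℕ} (hv : v < n) : chainProb n m v ≤ 1 := by
  have hn : 0 < n := by omega
  have hn' : (0 : ℝ) < n := by exact_mod_cast hn
  induction v using Nat.strong_induction_on with
  | _ v ih =>
    rw [chainProb_eq hn]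
    split_ifs
    · exact le_rfl
    · rw [div_le_one hn']
      calc ∑ u ∈ Finset.range v, chainProb n m u ≤ ∑ u ∈ Finset.range v, (1 : ℝ) :=
            Finset.sum_le_sum fun u hu => by
              rw [Finset.mem_range] at hu
              exact ih u hu (by omega)
        _ = v := by simp
        _ ≤ n := by exact_mod_cast hv.le

theorem sum_range_choose_eq (v K : ℕ) : ∑ u ∈ Finset.range v, u.choose K = v.choose (K + 1) := by
  induction v with
  | zero => simp
  | succ v ih => rw [Finset.sum_range_succ, ih, Nat.choose_succ_succ, add_comm]

/-- Both quantities obey the same recursion and differ by at most 1 at `K = 0`. Iterating the sum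
over smaller letters turns this 1 into a binomial coefficient, which counts the decreasing
continuations of length `K`. -/
theorem abs_chainAvg_sub_chainProb_le_choose (m : ℕ) {c : ℝ} (hc0 : 0 ≤ c) (hc1 : c ≤ 1) (K : ℕ)
    (v : Fin n) :
    |chainAvg m c K v - chainProb n m v| ≤ ((v : ℕ).choose K : ℝ) / (n : ℝ) ^ K := by
  have hn : 0 < n := Fin.pos v
  have hn' : (0 : ℝ) < n := by exact_mod_cast hn
  induction K generalizing v with
  | zero =>
    have h0 := chainProb_nonneg n m v
    have h1 := chainProb_le_one m v.2
    rw [chainAvg_zero]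
    simp only [Nat.choose_zero_right, Nat.cast_one, pow_zero, div_one]
    split_ifs <;> rw [abs_le] <;> constructor <;> linarith
  | succ K ih =>
    rw [chainAvg_succ, chainProb_eq hn]
    split_ifs with h
    · simp only [sub_self, abs_zero]; positivity
    · rw [← sum_fin_ite_lt v.2.le, ← sub_div, ← Finset.sum_sub_distrib, abs_div,
        abs_of_pos hn', pow_succ, ← div_div]
      gcongr
      calc |∑ u : Fin n, ((if (u : ℕ) < v then chainAvg m c K u else 0) -
              if (u : ℕ) < v then chainProb n m u else 0)|
          ≤ ∑ u : Fin n, |(if (u : ℕ) < v then chainAvg m c K u else 0) -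
              if (u : ℕ) < v then chainProb n m u else 0| := Finset.abs_sum_le_sum_abs _ _
        _ ≤ ∑ u : Fin n, if (u : ℕ) < v then ((u : ℕ).choose K : ℝ) / (n : ℝ) ^ K else 0 := by
            refine Finset.sum_le_sum fun u _ => ?_
            split_ifs
            · exact ih u
            · simp
        _ = (∑ u ∈ Finset.range v, (u.choose K : ℝ)) / (n : ℝ) ^ K := by
            rw [sum_fin_ite_lt v.2.le fun u => (u.choose K : ℝ) / (n : ℝ) ^ K, Finset.sum_div]
        _ = ((v : ℕ).choose (K + 1) : ℝ) / (n : ℝ) ^ K := by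
            congr 1
            rw [← Nat.cast_sum, sum_range_choose_eq]

theorem abs_chainAvg_sub_chainProb_le (m : ℕ) {c : ℝ} (hc0 : 0 ≤ c) (hc1 : c ≤ 1) (K : ℕ)
    (v : Fin n) :
    |chainAvg m c K v - chainProb n m v| ≤ 1 / K.factorial := by
  have hn' : (0 : ℝ) < n := by exact_mod_cast Fin.pos v
  refine (abs_chainAvg_sub_chainProb_le_choose m hc0 hc1 K v).trans ?_
  rw [div_le_iff₀ (by positivity), one_div, inv_mul_eq_div]
  refine (Nat.choose_le_pow_div K v).trans ?_
  gcongr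
  exact_mod_cast v.2.le

/-- `chainIndicator`, restricted to the words that start below `b`. -/
def boundedChainIndicator (m b : ℕ) (c : ℝ) (K : ℕ) (w : Fin (K + 1) → Fin n) : ℝ :=
  if (w 0 : ℕ) < b then chainIndicator m c K w else 0

theorem boundedChainIndicator_nonneg (m b : ℕ) {c : ℝ} (hc : 0 ≤ c) (K : ℕ)
    (w : Fin (K + 1) → Fin n) : 0 ≤ boundedChainIndicator m b c K w := by
  unfold boundedChainIndicator
  split_ifs
  · exact chainIndicator_nonneg m hc K w
  · exact le_rfl

theorem boundedChainIndicator_le_one (m b : ℕ) {c : ℝ} (hc : c ≤ 1) (K : ℕ)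
    (w : Fin (K + 1) → Fin n) : boundedChainIndicator m b c K w ≤ 1 := by
  unfold boundedChainIndicator
  split_ifs
  · exact chainIndicator_le_one m hc K w
  · exact zero_le_one

/-- The average of `chainProb` over the values below `b`, with total mass `n`. -/
noncomputable def chainMean (n m b : ℕ) : ℝ := (∑ v ∈ Finset.range b, chainProb n m v) / n

theorem chainMean_nonneg (n m b : ℕ) : 0 ≤ chainMean n m b :=
  div_nonneg (Finset.sum_nonneg fun _ _ => chainProb_nonneg _ _ _) (Nat.cast_nonneg _)

theorem abs_avg_boundedChainIndicator_sub_le (hn : 0 < n) (m : ℕ) {b : ℕ} (hb : b ≤ n) {c : ℝ}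
    (hc0 : 0 ≤ c) (hc1 : c ≤ 1) (K : ℕ) :
    |(∑ w : Fin (K + 1) → Fin n, boundedChainIndicator m b c K w) / (n : ℝ) ^ (K + 1) -
      chainMean n m b| ≤ 1 / K.factorial := by
  have hn' : (0 : ℝ) < n := by exact_mod_cast hn
  have hsum : (∑ w : Fin (K + 1) → Fin n, boundedChainIndicator m b c K w) / (n : ℝ) ^ (K + 1) =
      (∑ v : Fin n, if (v : ℕ) < b then chainAvg m c K v else 0) / n := by
    rw [sum_word_succ, pow_succ, ← div_div]
    congr 1
    rw [Finset.sum_div]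
    refine Finset.sum_congr rfl fun u _ => ?_
    simp only [boundedChainIndicator, Fin.cons_zero, chainAvg]
    split_ifs <;> simp
  rw [hsum, chainMean, ← sum_fin_ite_lt hb, ← sub_div, ← Finset.sum_sub_distrib, abs_div,
    abs_of_pos hn', div_le_iff₀ hn']
  calc |∑ u : Fin n, ((if (u : ℕ) < b then chainAvg m c K u else 0) -
          if (u : ℕ) < b then chainProb n m u else 0)|
      ≤ ∑ u : Fin n, |(if (u : ℕ) < b then chainAvg m c K u else 0) -
          if (u : ℕ) < b then chainProb n m u else 0| := Finset.abs_sum_le_sum_abs _ _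
    _ ≤ ∑ u : Fin n, (1 / K.factorial : ℝ) := by
        refine Finset.sum_le_sum fun u _ => ?_
        split_ifs
        · exact abs_chainAvg_sub_chainProb_le m hc0 hc1 K u
        · simp only [sub_self, abs_zero]; positivity
    _ = 1 / K.factorial * n := by simp [mul_comm]

end Chains

/-! ### First and second moments of the count of positions with low run minimum -/

section Moments

variable {n : ℕ}

theorem permAvg_const (n : ℕ) (c : ℝ) : permAvg n (fun _ => c) = c := by
  have : (n.factorial : ℝ) ≠ 0 := by exact_mod_cast n.factorial_ne_zero
  simp [permAvg, Fintype.card_perm, this]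

theorem permAvg_mono {f g : Equiv.Perm (Fin n) → ℝ} (h : ∀ π, f π ≤ g π) :
    permAvg n f ≤ permAvg n g := by
  unfold permAvg
  gcongr with π
  exact h π

theorem permAvg_sub (f g : Equiv.Perm (Fin n) → ℝ) :
    permAvg n (fun π => f π - g π) = permAvg n f - permAvg n g := by
  simp only [permAvg, Finset.sum_sub_distrib, sub_div]

theorem permAvg_add (f g : Equiv.Perm (Fin n) → ℝ) :
    permAvg n (fun π => f π + g π) = permAvg n f + permAvg n g := by
  simp only [permAvg, Finset.sum_add_distrib, add_div]

theorem permAvg_mul_left (c : ℝ) (f : Equiv.Perm (Fin n) → ℝ) :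
    permAvg n (fun π => c * f π) = c * permAvg n f := by
  simp only [permAvg, ← Finset.mul_sum, mul_div_assoc]

theorem permAvg_div (c : ℝ) (f : Equiv.Perm (Fin n) → ℝ) :
    permAvg n (fun π => f π / c) = permAvg n f / c := by
  simp only [permAvg, ← Finset.sum_div]
  rw [div_right_comm]

theorem permAvg_sum {ι : Type*} (s : Finset ι) (f : ι → Equiv.Perm (Fin n) → ℝ) :
    permAvg n (fun π => ∑ i ∈ s, f i π) = ∑ i ∈ s, permAvg n (f i) := by
  simp only [permAvg, ← Finset.sum_div]
  rw [Finset.sum_comm]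

theorem abs_permAvg_le (f : Equiv.Perm (Fin n) → ℝ) :
    |permAvg n f| ≤ permAvg n fun π => |f π| := by
  unfold permAvg
  rw [abs_div, Nat.abs_cast]
  gcongr
  exact Finset.abs_sum_le_sum_abs _ _

theorem sq_permAvg_le (f : Equiv.Perm (Fin n) → ℝ) :
    permAvg n f ^ 2 ≤ permAvg n fun π => f π ^ 2 := by
  have h := sq_sum_le_card_mul_sum_sq (s := (Finset.univ : Finset (Equiv.Perm (Fin n)))) (f := f)
  have hf : (0 : ℝ) < n.factorial := by exact_mod_cast n.factorial_pos
  rw [Finset.card_univ, Fintype.card_perm, Fintype.card_fin] at h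
  unfold permAvg
  rw [div_pow, div_le_div_iff₀ (by positivity) hf]
  nlinarith

/-- The event that the position `i` has `runMin π i < m` and `π i < b`, as a number. -/
def lowRunIndicator (π : Equiv.Perm (Fin n)) (m b : ℕ) (i : Fin n) : ℝ :=
  if (runMin π i : ℕ) < m ∧ (π i : ℕ) < b then 1 else 0

theorem lowRunIndicator_nonneg (π : Equiv.Perm (Fin n)) (m b : ℕ) (i : Fin n) :
    0 ≤ lowRunIndicator π m b i := by
  unfold lowRunIndicator; split_ifs <;> norm_num

theorem lowRunIndicator_le_one (π : Equiv.Perm (Fin n)) (m b : ℕ) (i : Fin n) :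
    lowRunIndicator π m b i ≤ 1 := by
  unfold lowRunIndicator; split_ifs <;> norm_num

theorem lowRunCount_eq_sum (π : Equiv.Perm (Fin n)) (m b : ℕ) :
    (lowRunCount π m b : ℝ) = ∑ i, lowRunIndicator π m b i := by
  simp [lowRunCount, lowRunIndicator]

theorem boundedChainIndicator_window_bounds (π : Equiv.Perm (Fin n)) (m b K : ℕ) (i : Fin n)
    (hi : K ≤ i) :
    boundedChainIndicator m b 0 K (π ∘ window K i) ≤ lowRunIndicator π m b i ∧
      lowRunIndicator π m b i ≤ boundedChainIndicator m b 1 K (π ∘ window K i) := by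
  have h := chainIndicator_window_bounds π m K i hi
  simp only [boundedChainIndicator, lowRunIndicator, Function.comp_apply, window_zero_right]
  by_cases hb : (π i : ℕ) < b
  · simpa [hb] using h
  · simp [hb]

/-- The factor in the comparison of `s` values of a uniform permutation of `Fin n` with
independent values. -/
noncomputable def injRatio (s n : ℕ) : ℝ := (n : ℝ) ^ s / n.descFactorial s

theorem injRatio_nonneg (s n : ℕ) : 0 ≤ injRatio s n := by unfold injRatio; positivity

theorem permAvg_lowRunIndicator_le (m : ℕ) {b : ℕ} (hb : b ≤ n) (K : ℕ) (i : Fin n) (hi : K ≤ i) :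
    permAvg n (fun π => lowRunIndicator π m b i) ≤
      injRatio (K + 1) n * (chainMean n m b + 1 / K.factorial) := by
  have h1 := avg_perm_le_avg_fun ⟨window K i, window_injective hi⟩
    (boundedChainIndicator_nonneg (n := n) m b zero_le_one K)
  have h2 := abs_avg_boundedChainIndicator_sub_le (Fin.pos i) m hb zero_le_one le_rfl K
  rw [Fintype.card_fin] at h1
  refine (permAvg_mono fun π => (boundedChainIndicator_window_bounds π m b K i hi).2).trans
    (h1.trans ?_)
  refine mul_le_mul_of_nonneg_left ?_ (injRatio_nonneg _ _)
  linarith [(abs_le.mp h2).2]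

/-- The comparison with independent letters only bounds from above, so it is applied to the
complementary event, with undecided readings counted as 0. -/
theorem le_permAvg_lowRunIndicator (m : ℕ) {b : ℕ} (hb : b ≤ n) (K : ℕ) (i : Fin n)
    (hi : K ≤ i) :
    1 - injRatio (K + 1) n * (1 - chainMean n m b + 1 / K.factorial) ≤
      permAvg n (fun π => lowRunIndicator π m b i) := by
  have hn : (n : ℝ) ≠ 0 := by exact_mod_cast (Fin.pos i).ne'
  have h1 := avg_perm_le_avg_fun ⟨window K i, window_injective hi⟩
    (φ := fun w => 1 - boundedChainIndicator m b 0 K w)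
    (fun w => sub_nonneg.mpr (boundedChainIndicator_le_one (n := n) m b zero_le_one K w))
  have h2 := abs_avg_boundedChainIndicator_sub_le (Fin.pos i) m hb le_rfl zero_le_one K
  rw [Fintype.card_fin] at h1
  have h3 : permAvg n (fun π => 1 - lowRunIndicator π m b i) ≤
      injRatio (K + 1) n * (1 - chainMean n m b + 1 / K.factorial) := by
    refine (permAvg_mono fun π => sub_le_sub_left
      (boundedChainIndicator_window_bounds π m b K i hi).1 1).trans (h1.trans ?_)
    refine mul_le_mul_of_nonneg_left ?_ (injRatio_nonneg _ _)
    rw [Finset.sum_sub_distrib, sub_div]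
    have : (∑ _w : Fin (K + 1) → Fin n, (1 : ℝ)) / (n : ℝ) ^ (K + 1) = 1 := by
      simp [hn]
    rw [this]
    linarith [(abs_le.mp h2).1]
  rw [permAvg_sub, permAvg_const] at h3
  linarith

/-- The two windows are disjoint and form a single embedding of 2(K+1) positions; for independent
letters the average of the product factors. -/
theorem permAvg_lowRunIndicator_mul_le (m : ℕ) {b : ℕ} (hb : b ≤ n) (K : ℕ) (i j : Fin n)
    (hi : K ≤ i) (hj : K ≤ j) (hij : (i : ℕ) + K < j ∨ (j : ℕ) + K < i) :
    permAvg n (fun π => lowRunIndicator π m b i * lowRunIndicator π m b j) ≤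
      injRatio (K + 1 + (K + 1)) n * (chainMean n m b + 1 / K.factorial) ^ 2 := by
  let e : Fin (K + 1) ⊕ Fin (K + 1) ↪ Fin n := ⟨Sum.elim (window K i) (window K j), by
    refine (window_injective hi).sumElim (window_injective hj) fun a a' h => ?_
    simp only [window, Fin.mk.injEq] at h
    omega⟩
  let Ψ : (Fin (K + 1) → Fin n) → ℝ := boundedChainIndicator m b 1 K
  have hΨ : ∀ w, 0 ≤ Ψ w := boundedChainIndicator_nonneg m b zero_le_one K
  have h1 := avg_perm_le_avg_fun e
    (φ := fun w => Ψ (w ∘ Sum.inl) * Ψ (w ∘ Sum.inr)) (fun w => mul_nonneg (hΨ _) (hΨ _))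
  have h2 := abs_avg_boundedChainIndicator_sub_le (Fin.pos i) m hb zero_le_one le_rfl K
  rw [Fintype.card_sum, Fintype.card_fin] at h1
  have hprod : ∑ w : Fin (K + 1) ⊕ Fin (K + 1) → Fin n, Ψ (w ∘ Sum.inl) * Ψ (w ∘ Sum.inr) =
      (∑ w, Ψ w) * ∑ w, Ψ w := by
    rw [Finset.sum_mul_sum, ← Fintype.sum_prod_type',
      ← (Equiv.sumArrowEquivProdArrow _ _ (Fin n)).sum_comp]
    rfl
  rw [hprod, pow_add (n : ℝ), mul_div_mul_comm, ← pow_add,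
    ← pow_two] at h1
  refine le_trans (permAvg_mono fun π => ?_) (h1.trans ?_)
  · exact mul_le_mul (boundedChainIndicator_window_bounds π m b K i hi).2
      (boundedChainIndicator_window_bounds π m b K j hj).2 (lowRunIndicator_nonneg _ _ _ _) (hΨ _)
  · refine mul_le_mul_of_nonneg_left ?_ (injRatio_nonneg _ _)
    have h0 : 0 ≤ (∑ w, Ψ w) / (n : ℝ) ^ (K + 1) :=
      div_nonneg (Finset.sum_nonneg fun w _ => hΨ w) (by positivity)
    refine pow_le_pow_left₀ h0 ?_ 2
    linarith [(abs_le.mp h2).2]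

theorem sum_ite_lt_le (n K : ℕ) : (∑ i : Fin n, if (i : ℕ) < K then (1 : ℝ) else 0) ≤ K := by
  rw [← Finset.sum_filter, Finset.sum_const, nsmul_eq_mul, mul_one, Fin.card_filter_val_lt]
  exact_mod_cast min_le_right _ _

theorem sum_ite_near_le (K : ℕ) (i : Fin n) :
    (∑ j : Fin n, if (j : ℕ) ≤ i + K ∧ (i : ℕ) ≤ j + K then (1 : ℝ) else 0) ≤ 2 * K + 1 := by
  rw [← Finset.sum_filter, Finset.sum_const, nsmul_eq_mul, mul_one]
  have h : (Finset.univ.filter fun j : Fin n => (j : ℕ) ≤ i + K ∧ (i : ℕ) ≤ j + K).card ≤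
      (Finset.Icc ((i : ℕ) - K) (i + K)).card :=
    Finset.card_le_card_of_injOn (fun j => (j : ℕ))
      (fun j hj => by
        simp only [Finset.coe_filter, Finset.mem_univ, true_and, mem_ofPred_eq] at hj
        simp only [Finset.coe_Icc, mem_Icc]
        omega)
      (fun _ _ _ _ h => Fin.ext h)
  rw [Nat.card_Icc] at h
  have h' := h.trans (show (i : ℕ) + K + 1 - (i - K) ≤ 2 * K + 1 by omega)
  exact_mod_cast h'

/-- The term `K / n` pays for the first `K` positions, whose windows do not fit and which get the
trivial bound 1. -/
theorem permAvg_lowRunCount_div_le (hn : 0 < n) (m : ℕ) {b : ℕ} (hb : b ≤ n) (K : ℕ) :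
    permAvg n (fun π => (lowRunCount π m b : ℝ) / n) ≤
      injRatio (K + 1) n * (chainMean n m b + 1 / K.factorial) + K / n := by
  have hn' : (0 : ℝ) < n := by exact_mod_cast hn
  set C := injRatio (K + 1) n * (chainMean n m b + 1 / K.factorial) with hC
  have hC0 : 0 ≤ C := mul_nonneg (injRatio_nonneg _ _)
    (add_nonneg (chainMean_nonneg _ _ _) (by positivity))
  rw [permAvg_div, div_le_iff₀ hn', add_mul, div_mul_cancel₀ _ hn'.ne']
  simp only [lowRunCount_eq_sum]
  rw [permAvg_sum]
  calc ∑ i, permAvg n (fun π => lowRunIndicator π m b i)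
      ≤ ∑ i : Fin n, (C + if (i : ℕ) < K then (1 : ℝ) else 0) := by
        refine Finset.sum_le_sum fun i _ => ?_
        split_ifs with h
        · have := permAvg_mono fun π => lowRunIndicator_le_one π m b i
          rw [permAvg_const] at this
          linarith
        · rw [add_zero]
          exact permAvg_lowRunIndicator_le m hb K i (not_lt.mp h)
    _ ≤ C * n + K := by
        rw [Finset.sum_add_distrib]
        have := sum_ite_lt_le n K
        simp only [Finset.sum_const, Finset.card_univ, Fintype.card_fin, nsmul_eq_mul]
        linarith

theorem le_permAvg_lowRunCount_div (hn : 0 < n) (m : ℕ) {b : ℕ} (hb : b ≤ n) (K : ℕ) :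
    1 - injRatio (K + 1) n * (1 - chainMean n m b + 1 / K.factorial) - K / n ≤
      permAvg n (fun π => (lowRunCount π m b : ℝ) / n) := by
  have hn' : (0 : ℝ) < n := by exact_mod_cast hn
  have hq : chainMean n m b ≤ 1 := by
    rw [chainMean, div_le_one hn']
    calc ∑ v ∈ Finset.range b, chainProb n m v ≤ ∑ v ∈ Finset.range b, (1 : ℝ) :=
          Finset.sum_le_sum fun v hv => chainProb_le_one m ((Finset.mem_range.mp hv).trans_le hb)
      _ = b := by simp
      _ ≤ n := by exact_mod_cast hb
  set C := injRatio (K + 1) n * (1 - chainMean n m b + 1 / K.factorial) with hC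
  have hC0 : 0 ≤ C := mul_nonneg (injRatio_nonneg _ _)
    (add_nonneg (sub_nonneg.mpr hq) (by positivity))
  rw [permAvg_div, le_div_iff₀ hn', sub_mul, div_mul_cancel₀ _ hn'.ne']
  simp only [lowRunCount_eq_sum]
  rw [permAvg_sum]
  calc (1 - C) * n - K ≤ ∑ i : Fin n, ((1 - C) - if (i : ℕ) < K then (1 : ℝ) else 0) := by
        rw [Finset.sum_sub_distrib]
        have := sum_ite_lt_le n K
        simp only [Finset.sum_const, Finset.card_univ, Fintype.card_fin, nsmul_eq_mul]
        linarith
    _ ≤ ∑ i, permAvg n (fun π => lowRunIndicator π m b i) := by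
        refine Finset.sum_le_sum fun i _ => ?_
        split_ifs with h
        · have := permAvg_mono fun π => lowRunIndicator_nonneg π m b i
          rw [permAvg_const] at this
          linarith
        · rw [sub_zero]
          exact le_permAvg_lowRunIndicator m hb K i (not_lt.mp h)

/-- The exceptional pairs get the trivial bound 1: at most K n with `i < K`, K n with `j < K`, and
(2K+1) n with overlapping windows, hence `4 * K + 1`. -/
theorem permAvg_sq_lowRunCount_div_le (hn : 0 < n) (m : ℕ) {b : ℕ} (hb : b ≤ n) (K : ℕ) :
    permAvg n (fun π => ((lowRunCount π m b : ℝ) / n) ^ 2) ≤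
      injRatio (K + 1 + (K + 1)) n * (chainMean n m b + 1 / K.factorial) ^ 2 +
        (4 * K + 1) / n := by
  have hn' : (0 : ℝ) < n := by exact_mod_cast hn
  set C := injRatio (K + 1 + (K + 1)) n * (chainMean n m b + 1 / K.factorial) ^ 2 with hC
  have hC0 : 0 ≤ C := mul_nonneg (injRatio_nonneg _ _) (by positivity)
  simp only [div_pow]
  rw [permAvg_div, div_le_iff₀ (by positivity)]
  have hsq : ∀ π : Equiv.Perm (Fin n), (lowRunCount π m b : ℝ) ^ 2 =
      ∑ i, ∑ j, lowRunIndicator π m b i * lowRunIndicator π m b j := fun π => by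
    rw [lowRunCount_eq_sum, pow_two, Finset.sum_mul_sum]
  simp only [hsq]
  rw [permAvg_sum]
  simp only [permAvg_sum]
  calc ∑ i, ∑ j, permAvg n (fun π => lowRunIndicator π m b i * lowRunIndicator π m b j)
      ≤ ∑ i : Fin n, ∑ j : Fin n, (((C + if (i : ℕ) < K then (1 : ℝ) else 0) +
          if (j : ℕ) < K then (1 : ℝ) else 0) +
          if (j : ℕ) ≤ i + K ∧ (i : ℕ) ≤ j + K then (1 : ℝ) else 0) := by
        refine Finset.sum_le_sum fun i _ => Finset.sum_le_sum fun j _ => ?_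
        have hone : permAvg n (fun π => lowRunIndicator π m b i * lowRunIndicator π m b j) ≤ 1 := by
          rw [← permAvg_const n 1]
          exact permAvg_mono fun π => mul_le_one₀ (lowRunIndicator_le_one π m b i)
            (lowRunIndicator_nonneg π m b j) (lowRunIndicator_le_one π m b j)
        by_cases h1 : (i : ℕ) < K
        · rw [if_pos h1]
          split_ifs
          all_goals linarith
        by_cases h2 : (j : ℕ) < K
        · rw [if_pos h2]
          split_ifs <;> linarith
        by_cases h3 : (j : ℕ) ≤ i + K ∧ (i : ℕ) ≤ j + K
        · rw [if_pos h3]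
          split_ifs
          all_goals linarith
        rw [if_neg h1, if_neg h2, if_neg h3, add_zero, add_zero, add_zero]
        exact permAvg_lowRunIndicator_mul_le m hb K i j (by omega) (by omega) (by omega)
    _ ≤ ∑ i : Fin n, ((C * n + (if (i : ℕ) < K then (1 : ℝ) else 0) * n) + K + (2 * K + 1)) := by
        refine Finset.sum_le_sum fun i _ => ?_
        rw [Finset.sum_add_distrib, Finset.sum_add_distrib]
        have h1 := sum_ite_lt_le n K
        have h2 := sum_ite_near_le K i
        simp only [Finset.sum_const, Finset.card_univ, Fintype.card_fin, nsmul_eq_mul]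
        linarith
    _ ≤ (C + (4 * K + 1) / n) * n ^ 2 := by
        rw [Finset.sum_add_distrib, Finset.sum_add_distrib, Finset.sum_add_distrib]
        have h1 := mul_le_mul_of_nonneg_right (sum_ite_lt_le n K) hn'.le
        rw [Finset.sum_mul] at h1
        have h2 : (C + (4 * K + 1) / n) * (n : ℝ) ^ 2 = C * n ^ 2 + (4 * K + 1) * n := by
          field_simp
        rw [h2]
        simp only [Finset.sum_const, Finset.card_univ, Fintype.card_fin, nsmul_eq_mul]
        nlinarith

end Moments

/-! ### Asymptotics of the counts -/

section Limits

theorem tendsto_injRatio (s : ℕ) : Tendsto (fun n => injRatio s n) atTop (𝓝 1) := by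
  have h := (isEquivalent_descFactorial s).symm
  rwa [Asymptotics.isEquivalent_iff_tendsto_one] at h
  filter_upwards [eventually_ge_atTop s] with n hn
  rw [Ne, Nat.cast_eq_zero, Nat.descFactorial_eq_zero_iff_lt]
  omega

theorem tendsto_floor_mul_div {t : ℝ} (ht : 0 ≤ t) :
    Tendsto (fun n : ℕ => (⌊t * n⌋₊ : ℝ) / n) atTop (𝓝 t) :=
  (tendsto_nat_floor_mul_div_atTop ht).comp tendsto_natCast_atTop_atTop

/-- The power is exp((k/n) · n log(1 + 1/n)), and n log(1 + 1/n) tends to 1. -/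
theorem tendsto_one_add_inv_pow {k : ℕ → ℕ} {t : ℝ}
    (hk : Tendsto (fun n => (k n : ℝ) / n) atTop (𝓝 t)) :
    Tendsto (fun n : ℕ => (1 + 1 / (n : ℝ)) ^ k n) atTop (𝓝 (Real.exp t)) := by
  have h1 : Tendsto (fun n : ℕ => (n : ℝ) * Real.log (1 + 1 / (n : ℝ))) atTop (𝓝 1) :=
    (Real.tendsto_mul_log_one_add_div_atTop 1).comp tendsto_natCast_atTop_atTop
  have h2 := (Real.continuous_exp.tendsto _).comp (hk.mul h1)
  rw [mul_one] at h2
  refine h2.congr' ?_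
  filter_upwards [eventually_gt_atTop 0] with n hn
  have hn' : (0 : ℝ) < n := by exact_mod_cast hn
  have hpos : (0 : ℝ) < 1 + 1 / n := by positivity
  rw [Function.comp_apply, ← mul_assoc, div_mul_cancel₀ _ hn'.ne', ← Real.log_pow,
    Real.exp_log (by positivity)]

theorem tendsto_chainMean {s t : ℝ} (hs : 0 ≤ s) (hst : s ≤ t) :
    Tendsto (fun n : ℕ => chainMean n ⌊s * n⌋₊ ⌊t * n⌋₊) atTop (𝓝 (s * Real.exp (t - s))) := by
  have hle : ∀ n : ℕ, ⌊s * n⌋₊ ≤ ⌊t * n⌋₊ := fun n => Nat.floor_mono (by gcongr)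
  have hk : Tendsto (fun n : ℕ => ((⌊t * n⌋₊ - ⌊s * n⌋₊ : ℕ) : ℝ) / n) atTop (𝓝 (t - s)) := by
    refine ((tendsto_floor_mul_div (hs.trans hst)).sub (tendsto_floor_mul_div hs)).congr
      fun n => ?_
    rw [Nat.cast_sub (hle n), sub_div]
  refine ((tendsto_floor_mul_div hs).mul (tendsto_one_add_inv_pow hk)).congr' ?_
  filter_upwards [eventually_gt_atTop 0] with n hn
  rw [chainMean, sum_chainProb hn (hle n)]
  ring

theorem floor_mul_le {t : ℝ} (ht : t ≤ 1) (n : ℕ) : ⌊t * n⌋₊ ≤ n :=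
  Nat.floor_le_of_le (mul_le_of_le_one_left (Nat.cast_nonneg n) ht)

theorem tendsto_one_div_factorial :
    Tendsto (fun K : ℕ => (1 : ℝ) / K.factorial) atTop (𝓝 0) := by
  simpa using FloorSemiring.tendsto_pow_div_factorial_atTop (1 : ℝ)

theorem tendsto_permAvg_lowRunCount {s t : ℝ} (hs : 0 ≤ s) (hst : s ≤ t) (ht : t ≤ 1) :
    Tendsto (fun n : ℕ => permAvg n fun π => (lowRunCount π ⌊s * n⌋₊ ⌊t * n⌋₊ : ℝ) / n) atTop
      (𝓝 (s * Real.exp (t - s))) := by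
  have hq := tendsto_chainMean hs hst
  set L := s * Real.exp (t - s)
  have hK : ∀ K : ℕ, Tendsto (fun n : ℕ => (K : ℝ) / n) atTop (𝓝 0) := fun K =>
    tendsto_const_div_atTop_nhds_zero_nat _
  rw [tendsto_order]
  constructor
  · intro a ha
    -- `K` is fixed first, with 1/K! smaller than the gap `L - a`. Only then does `n` grow; the
    -- right side is the limit of the lower bound for this `K`.
    obtain ⟨K, hKa⟩ : ∃ K : ℕ, a < 1 - 1 * (1 - L + 1 / K.factorial) - 0 := by
      have h := (tendsto_one_div_factorial.eventually_lt_const (sub_pos.mpr ha)).exists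
      obtain ⟨K, hK⟩ := h
      exact ⟨K, by linarith⟩
    have hlim := ((tendsto_const_nhds (x := (1 : ℝ))).sub ((tendsto_injRatio (K + 1)).mul
      (((tendsto_const_nhds (x := (1 : ℝ))).sub hq).add
        (tendsto_const_nhds (x := (1 : ℝ) / K.factorial))))).sub (hK K)
    filter_upwards [hlim.eventually_const_lt hKa, eventually_gt_atTop 0] with n hn h0
    exact hn.trans_le (le_permAvg_lowRunCount_div h0 _ (floor_mul_le ht n) K)
  · intro a ha
    obtain ⟨K, hKa⟩ : ∃ K : ℕ, 1 * (L + 1 / K.factorial) + 0 < a := by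
      have h := (tendsto_one_div_factorial.eventually_lt_const (sub_pos.mpr ha)).exists
      obtain ⟨K, hK⟩ := h
      exact ⟨K, by linarith⟩
    have hlim := ((tendsto_injRatio (K + 1)).mul
      (hq.add (tendsto_const_nhds (x := (1 : ℝ) / K.factorial)))).add (hK K)
    filter_upwards [hlim.eventually_lt_const hKa, eventually_gt_atTop 0] with n hn h0
    exact (permAvg_lowRunCount_div_le h0 _ (floor_mul_le ht n) K).trans_lt hn

/-- An upper bound suffices for concentration, since the mean square deviation is nonnegative
anyway. -/
theorem eventually_permAvg_sq_lowRunCount_lt {s t : ℝ} (hs : 0 ≤ s) (hst : s ≤ t) (ht : t ≤ 1)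
    {a : ℝ} (ha : (s * Real.exp (t - s)) ^ 2 < a) :
    ∀ᶠ n : ℕ in atTop,
      permAvg n (fun π => ((lowRunCount π ⌊s * n⌋₊ ⌊t * n⌋₊ : ℝ) / n) ^ 2) < a := by
  have hq := tendsto_chainMean hs hst
  set L := s * Real.exp (t - s)
  obtain ⟨K, hKa⟩ : ∃ K : ℕ, 1 * (L + 1 / K.factorial) ^ 2 + 0 < a := by
    have h : Tendsto (fun K : ℕ => 1 * (L + 1 / K.factorial) ^ 2 + 0) atTop (𝓝 (L ^ 2)) := by
      simpa using (tendsto_one_div_factorial.const_add L).pow 2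
    exact (h.eventually_lt_const ha).exists
  have hlim := ((tendsto_injRatio (K + 1 + (K + 1))).mul
    ((hq.add (tendsto_const_nhds (x := (1 : ℝ) / K.factorial))).pow 2)).add
    (tendsto_const_div_atTop_nhds_zero_nat (4 * (K : ℝ) + 1))
  filter_upwards [hlim.eventually_lt_const hKa, eventually_gt_atTop 0] with n hn h0
  exact (permAvg_sq_lowRunCount_div_le h0 _ (floor_mul_le ht n) K).trans_lt hn

/-- Concentration: the fraction of positions with `runMin π k < s n` is close to
`s * exp (1 - s)`. -/
theorem tendsto_permAvg_sq_sub {s : ℝ} (hs : 0 ≤ s) (hs1 : s ≤ 1) :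
    Tendsto (fun n : ℕ => permAvg n fun π =>
      ((lowRunCount π ⌊s * n⌋₊ n : ℝ) / n - s * Real.exp (1 - s)) ^ 2) atTop (𝓝 0) := by
  have h1 := tendsto_permAvg_lowRunCount hs hs1 le_rfl
  have h2 := fun a => eventually_permAvg_sq_lowRunCount_lt hs hs1 le_rfl (a := a)
  simp only [one_mul, Nat.floor_natCast] at h1 h2
  set L := s * Real.exp (1 - s)
  have hexp : ∀ n : ℕ, (permAvg n fun π => ((lowRunCount π ⌊s * n⌋₊ n : ℝ) / n - L) ^ 2) =
      permAvg n (fun π => ((lowRunCount π ⌊s * n⌋₊ n : ℝ) / n) ^ 2) -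
        2 * L * permAvg n (fun π => (lowRunCount π ⌊s * n⌋₊ n : ℝ) / n) + L ^ 2 := by
    intro n
    rw [← permAvg_mul_left, ← permAvg_sub, ← permAvg_const n (L ^ 2), ← permAvg_add]
    congr 1
    ext π
    ring
  rw [tendsto_order]
  constructor
  · intro a ha
    refine Eventually.of_forall fun n => ha.trans_le ?_
    rw [← permAvg_const n 0]
    exact permAvg_mono fun π => sq_nonneg _
  · intro a ha
    -- In E X² - 2L E X + L², the first term may exceed L² by a/2 and the second may fall short of
    -- 2L² by a/2.
    have h3 := (h1.const_mul (2 * L)).eventually_const_lt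
      (show 2 * L * L - a / 2 < 2 * L * L by linarith)
    filter_upwards [h2 (L ^ 2 + a / 2) (by linarith), h3] with n hn hn'
    rw [hexp]
    nlinarith

theorem tendsto_permAvg_abs_sub {s : ℝ} (hs : 0 ≤ s) (hs1 : s ≤ 1) :
    Tendsto (fun n : ℕ => permAvg n fun π =>
      |(lowRunCount π ⌊s * n⌋₊ n : ℝ) / n - s * Real.exp (1 - s)|) atTop (𝓝 0) := by
  have h := (Real.continuous_sqrt.tendsto _).comp (tendsto_permAvg_sq_sub hs hs1)
  rw [Real.sqrt_zero] at h
  refine squeeze_zero (fun n => ?_) (fun n => ?_) h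
  · rw [← permAvg_const n 0]
    exact permAvg_mono fun π => abs_nonneg _
  · refine Real.le_sqrt_of_sq_le ((sq_permAvg_le _).trans (le_of_eq ?_))
    simp only [sq_abs]

theorem exists_mul_exp_eq {x : ℝ} (hx : x ∈ Icc (0 : ℝ) 1) :
    ∃ s ∈ Icc (0 : ℝ) 1, s * Real.exp (1 - s) = x := by
  have hc : ContinuousOn (fun s : ℝ => s * Real.exp (1 - s)) (Icc 0 1) := by fun_prop
  have := intermediate_value_Icc zero_le_one hc
  simp only [zero_mul, sub_self, Real.exp_zero, mul_one] at this
  exact this hx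

/-- The derivative is (1 - s) e^(1-s). Monotonicity makes the curve a graph over `x`, and the
position of `y` relative to that graph selects the branch of the minimum. -/
theorem strictMonoOn_mul_exp : StrictMonoOn (fun s : ℝ => s * Real.exp (1 - s)) (Icc 0 1) := by
  refine strictMonoOn_of_deriv_pos (convex_Icc 0 1) (by fun_prop) fun s hs => ?_
  rw [interior_Icc] at hs
  have h : HasDerivAt (fun s : ℝ => s * Real.exp (1 - s))
      (1 * Real.exp (1 - s) + s * (Real.exp (1 - s) * (-1))) s :=
    (hasDerivAt_id s).mul (((hasDerivAt_id s).const_sub 1).exp)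
  rw [h.deriv]
  have := Real.exp_pos (1 - s)
  nlinarith [hs.2]

/-- The expected joint distribution function of `runsort π` converges to
`min y (x * exp (y - 1))`. -/
theorem tendsto_permAvg_runsortCount {x y : ℝ} (hx : x ∈ Icc (0 : ℝ) 1) (hy : y ∈ Icc (0 : ℝ) 1) :
    Tendsto (fun n : ℕ => permAvg n fun π => (runsortCount π ⌊x * n⌋₊ ⌊y * n⌋₊ : ℝ) / n) atTop
      (𝓝 (min y (x * Real.exp (y - 1)))) := by
  obtain ⟨s, hs, hsx⟩ := exists_mul_exp_eq hx
  have hmain : Tendsto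
      (fun n : ℕ => permAvg n fun π => (lowRunCount π ⌊s * n⌋₊ ⌊y * n⌋₊ : ℝ) / n) atTop
      (𝓝 (min y (x * Real.exp (y - 1)))) := by
    -- `s` is the height of the curve above `x`. For `y ≤ s`, every entry below `y n` already has
    -- run minimum below `s n`, so the count is exact; for `s ≤ y`, the limit s e^(y-s) equals x
    -- e^(y-1).
    rcases le_total y s with h | h
    · have hyx : y * Real.exp (1 - y) ≤ x := by
        rw [← hsx]
        exact strictMonoOn_mul_exp.monotoneOn hy hs h
      have hle : y ≤ x * Real.exp (y - 1) := by
        have := mul_le_mul_of_nonneg_right hyx (Real.exp_pos (y - 1)).le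
        rwa [mul_assoc, ← Real.exp_add, show 1 - y + (y - 1) = 0 by ring, Real.exp_zero,
          mul_one] at this
      rw [min_eq_left hle]
      refine (tendsto_floor_mul_div hy.1).congr fun n => ?_
      have hc : ∀ π : Equiv.Perm (Fin n), lowRunCount π ⌊s * n⌋₊ ⌊y * n⌋₊ = ⌊y * n⌋₊ := fun π =>
        lowRunCount_of_le π (Nat.floor_mono (by gcongr)) (floor_mul_le hy.2 n)
      simp only [hc, permAvg_const]
    · have he : x * Real.exp (y - 1) = s * Real.exp (y - s) := by
        rw [← hsx, mul_assoc, ← Real.exp_add]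
        congr 2
        ring
      have hxy : s * Real.exp (1 - s) ≤ y * Real.exp (1 - y) :=
        strictMonoOn_mul_exp.monotoneOn hs hy h
      have hle : x * Real.exp (y - 1) ≤ y := by
        rw [hsx] at hxy
        have := mul_le_mul_of_nonneg_right hxy (Real.exp_pos (y - 1)).le
        rwa [mul_assoc y, ← Real.exp_add, show 1 - y + (y - 1) = 0 by ring, Real.exp_zero,
          mul_one] at this
      rw [min_eq_right hle, he]
      exact tendsto_permAvg_lowRunCount hs.1 h hy.2
  -- This bounds the cost of cutting `runsort π` at ⌊xn⌋ instead of at the random end of the block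
  -- of low runs.
  have herr : Tendsto (fun n : ℕ => (permAvg n fun π =>
      |(lowRunCount π ⌊s * n⌋₊ n : ℝ) / n - x|) + |x - (⌊x * n⌋₊ : ℝ) / n|) atTop (𝓝 0) := by
    have h1 := tendsto_permAvg_abs_sub hs.1 hs.2
    rw [hsx] at h1
    have h2 := ((tendsto_floor_mul_div hx.1).const_sub x).abs
    simpa using h1.add h2
  have hdiff : Tendsto (fun n : ℕ =>
      (permAvg n fun π => (runsortCount π ⌊x * n⌋₊ ⌊y * n⌋₊ : ℝ) / n) -
        permAvg n fun π => (lowRunCount π ⌊s * n⌋₊ ⌊y * n⌋₊ : ℝ) / n) atTop (𝓝 0) := by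
    refine squeeze_zero_norm (fun n => ?_) herr
    rw [Real.norm_eq_abs, ← permAvg_sub, ← permAvg_const n |x - (⌊x * n⌋₊ : ℝ) / n|,
      ← permAvg_add]
    refine (abs_permAvg_le _).trans (permAvg_mono fun π => ?_)
    have hb := abs_runsortCount_sub_lowRunCount_le π ⌊x * n⌋₊ ⌊s * n⌋₊ ⌊y * n⌋₊
    rw [← sub_div, abs_div, Nat.abs_cast]
    refine (div_le_div_of_nonneg_right hb (Nat.cast_nonneg n)).trans ?_
    rw [← Nat.abs_cast n, ← abs_div, sub_div, Nat.abs_cast]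
    exact abs_sub_le _ _ _
  simpa using hdiff.add hmain

end Limits

/-! ### The limit measure `R` and its distribution function -/

section LimitMeasure

theorem mul_exp_mem_Icc {t : ℝ} (ht : t ∈ Icc (0 : ℝ) 1) : t * Real.exp (1 - t) ∈ Icc (0 : ℝ) 1 := by
  refine ⟨mul_nonneg ht.1 (Real.exp_pos _).le, ?_⟩
  have := strictMonoOn_mul_exp.monotoneOn ht (right_mem_Icc.mpr zero_le_one) ht.2
  simpa using this

theorem measurableSet_Cplus : MeasurableSet Cplus :=
  (measurableSet_Icc.prod measurableSet_Icc).inter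
    (measurableSet_lt measurable_fst (by fun_prop))

/-- Slice at height t: the region contributes a segment with density e^(t-1), the curve an atom of
mass 1 - t at the right end of that segment. -/
theorem R_prod {A B : Set ℝ} (hA : MeasurableSet A) (hB : MeasurableSet B) :
    R (A ×ˢ B) = ∫⁻ t in B ∩ Icc 0 1,
      (ENNReal.ofReal (Real.exp (t - 1)) * volume (A ∩ Ico 0 (t * Real.exp (1 - t))) +
        A.indicator (fun _ => ENNReal.ofReal (1 - t)) (t * Real.exp (1 - t))) := by
  have hAB := hA.prod hB
  have hg : Measurable fun t : ℝ => (t * Real.exp (1 - t), t) := by fun_prop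
  have hBI : MeasurableSet (B ∩ Icc (0 : ℝ) 1) := hB.inter measurableSet_Icc
  have hpre : MeasurableSet ((fun t : ℝ => (t * Real.exp (1 - t), t)) ⁻¹' A ×ˢ B) := hg hAB
  have hcurve : ((volume.restrict (Icc (0 : ℝ) 1)).withDensity
      (fun y => ENNReal.ofReal (1 - y))).map (fun y : ℝ => (y * Real.exp (1 - y), y)) (A ×ˢ B) =
      ∫⁻ t in B ∩ Icc 0 1,
        A.indicator (fun _ => ENNReal.ofReal (1 - t)) (t * Real.exp (1 - t)) := by
    rw [Measure.map_apply hg hAB, withDensity_apply _ hpre, Measure.restrict_restrict hpre,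
      ← lintegral_indicator (hpre.inter measurableSet_Icc), ← lintegral_indicator hBI]
    refine lintegral_congr fun t => ?_
    classical
    simp only [indicator_apply, mem_inter_iff, mem_preimage, mem_prod]
    split_ifs <;> first | rfl | (exfalso; tauto)
  have harea : ((volume.restrict Cplus).withDensity
      (fun q => ENNReal.ofReal (Real.exp (q.2 - 1)))) (A ×ˢ B) =
      ∫⁻ t in B ∩ Icc 0 1,
        ENNReal.ofReal (Real.exp (t - 1)) * volume (A ∩ Ico 0 (t * Real.exp (1 - t))) := by
    have hm : Measurable fun q : ℝ × ℝ => ENNReal.ofReal (Real.exp (q.2 - 1)) := by fun_prop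
    have hS := hAB.inter measurableSet_Cplus
    rw [withDensity_apply _ hAB, Measure.restrict_restrict hAB, ← lintegral_indicator hS,
      Measure.volume_eq_prod, lintegral_prod_symm _ (hm.indicator hS).aemeasurable,
      ← lintegral_indicator hBI]
    refine lintegral_congr fun t => ?_
    have hAI : MeasurableSet (A ∩ Ico 0 (t * Real.exp (1 - t))) := hA.inter measurableSet_Ico
    by_cases ht : t ∈ B ∩ Icc (0 : ℝ) 1
    · rw [indicator_of_mem ht, ← setLIntegral_const, ← lintegral_indicator hAI]
      refine lintegral_congr fun s => ?_
      have hiff : (s, t) ∈ A ×ˢ B ∩ Cplus ↔ s ∈ A ∩ Ico 0 (t * Real.exp (1 - t)) := by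
        -- The slice ends at t e^(1-t) ≤ 1, so the constraint that the abscissa be at most 1 is
        -- automatic.
        have h1 := (mul_exp_mem_Icc ht.2).2
        simp only [mem_inter_iff, mem_prod, Cplus, mem_ofPred_eq, mem_Ico]
        constructor
        · rintro ⟨⟨h, -⟩, ⟨h2, -⟩, h3⟩
          exact ⟨h, h2.1, h3⟩
        · rintro ⟨h, h2, h3⟩
          exact ⟨⟨h, ht.1⟩, ⟨⟨h2, by linarith⟩, ht.2⟩, h3⟩
      by_cases hs : s ∈ A ∩ Ico 0 (t * Real.exp (1 - t))
      · rw [indicator_of_mem hs, indicator_of_mem (hiff.mpr hs)]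
      · rw [indicator_of_notMem hs, indicator_of_notMem (mt hiff.mp hs)]
    · rw [indicator_of_notMem ht, ← lintegral_zero]
      refine lintegral_congr fun s => indicator_of_notMem (fun h => ht ?_) _
      exact ⟨h.1.2, h.2.1.2⟩
  rw [R, Measure.add_apply, hcurve, harea, ← lintegral_add_right]
  have : (fun t : ℝ => A.indicator (fun _ => ENNReal.ofReal (1 - t)) (t * Real.exp (1 - t))) =
      ((fun t : ℝ => t * Real.exp (1 - t)) ⁻¹' A).indicator fun t => ENNReal.ofReal (1 - t) := rfl
  rw [this]
  exact Measurable.indicator (by fun_prop) ((by fun_prop : Measurable _) hA)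

/-- The region carries mass t at height t, which complements the mass 1 - t of the curve; hence the
second marginal is uniform. -/
theorem exp_mul_mul_exp (t : ℝ) : Real.exp (t - 1) * (t * Real.exp (1 - t)) = t := by
  rw [mul_left_comm, ← Real.exp_add, show t - 1 + (1 - t) = 0 by ring, Real.exp_zero, mul_one]

theorem R_Iic_prod (x : ℝ) {B : Set ℝ} (hB : MeasurableSet B) :
    R (Iic x ×ˢ B) = ∫⁻ t in B ∩ Icc 0 1,
      if t * Real.exp (1 - t) ≤ x then 1 else ENNReal.ofReal (x * Real.exp (t - 1)) := by
  rw [R_prod measurableSet_Iic hB]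
  refine setLIntegral_congr_fun (hB.inter measurableSet_Icc) fun t ht => ?_
  have he := (Real.exp_pos (t - 1)).le
  simp only [indicator_apply, mem_Iic]
  split_ifs with h
  · have : Iic x ∩ Ico 0 (t * Real.exp (1 - t)) = Ico 0 (t * Real.exp (1 - t)) :=
      inter_eq_self_of_subset_right fun s hs => hs.2.le.trans h
    rw [this, Real.volume_Ico, sub_zero, ← ENNReal.ofReal_mul he, exp_mul_mul_exp,
      ← ENNReal.ofReal_add ht.2.1 (sub_nonneg.mpr ht.2.2)]
    simp
  · have : Iic x ∩ Ico 0 (t * Real.exp (1 - t)) = Icc 0 x := by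
      ext s
      simp only [mem_inter_iff, mem_Iic, mem_Ico, mem_Icc]
      constructor
      · rintro ⟨h1, h2, -⟩
        exact ⟨h2, h1⟩
      · rintro ⟨h1, h2⟩
        exact ⟨h2, h1, by linarith⟩
    rw [this, Real.volume_Icc, sub_zero, ← ENNReal.ofReal_mul he, add_zero, mul_comm]

theorem R_univ_prod {B : Set ℝ} (hB : MeasurableSet B) :
    R (univ ×ˢ B) = volume (B ∩ Icc 0 1) := by
  rw [R_prod MeasurableSet.univ hB, ← setLIntegral_one]
  refine setLIntegral_congr_fun (hB.inter measurableSet_Icc) fun t ht => ?_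
  have he := (Real.exp_pos (t - 1)).le
  simp only [indicator_univ, univ_inter]
  rw [Real.volume_Ico, sub_zero, ← ENNReal.ofReal_mul he, exp_mul_mul_exp,
    ← ENNReal.ofReal_add ht.2.1 (sub_nonneg.mpr ht.2.2)]
  simp

/-- Slices below the height s of the curve above `x` count fully; beyond s the density is x e^(t-1),
whose primitive takes the value s at t = s, so the two parts combine to x e^(y-1). -/
theorem R_Iic_prod_Iic {x y : ℝ} (hx : x ∈ Icc (0 : ℝ) 1) (hy : y ∈ Icc (0 : ℝ) 1) :
    R (Iic x ×ˢ Iic y) = ENNReal.ofReal (min y (x * Real.exp (y - 1))) := by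
  obtain ⟨s, hs, hsx⟩ := exists_mul_exp_eq hx
  have hmono := strictMonoOn_mul_exp
  have hset : Iic y ∩ Icc 0 1 = Icc 0 y := by
    ext t
    simp only [mem_inter_iff, mem_Iic, mem_Icc]
    constructor
    · rintro ⟨h1, h2, -⟩
      exact ⟨h2, h1⟩
    · rintro ⟨h1, h2⟩
      exact ⟨h2, h1, h2.trans hy.2⟩
  have hiff : ∀ t ∈ Icc (0 : ℝ) 1, (t * Real.exp (1 - t) ≤ x ↔ t ≤ s) := fun t ht => by
    rw [← hsx]
    exact hmono.le_iff_le ht hs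
  have hlow : ∀ r ≤ s, ∫⁻ t in Icc 0 r,
      (if t * Real.exp (1 - t) ≤ x then 1 else ENNReal.ofReal (x * Real.exp (t - 1))) =
        ENNReal.ofReal r := by
    intro r hr
    rw [setLIntegral_congr_fun (g := fun _ => 1) measurableSet_Icc]
    · rw [setLIntegral_one, Real.volume_Icc, sub_zero]
    · intro t ht
      have : t ∈ Icc (0 : ℝ) 1 := ⟨ht.1, ht.2.trans (hr.trans hs.2)⟩
      exact if_pos ((hiff t this).mpr (ht.2.trans hr))
  have hyy : y * Real.exp (1 - y) * Real.exp (y - 1) = y := by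
    rw [mul_comm, exp_mul_mul_exp]
  rw [R_Iic_prod x measurableSet_Iic, hset]
  rcases le_total y s with h | h
  · have h1 : y * Real.exp (1 - y) ≤ x := (hiff y hy).mpr h
    have h2 := mul_le_mul_of_nonneg_right h1 (Real.exp_pos (y - 1)).le
    rw [hyy] at h2
    rw [min_eq_left h2, hlow y h]
  · have h1 : x ≤ y * Real.exp (1 - y) := by
      rw [← hsx]
      exact hmono.monotoneOn hs hy h
    have h2 := mul_le_mul_of_nonneg_right h1 (Real.exp_pos (y - 1)).le
    rw [hyy] at h2
    rw [min_eq_right h2, ← Icc_union_Ioc_eq_Icc hs.1 h, lintegral_union measurableSet_Ioc,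
      hlow s le_rfl]
    · have hcont : Continuous fun t : ℝ => x * Real.exp (t - 1) := by fun_prop
      rw [setLIntegral_congr_fun (g := fun t => ENNReal.ofReal (x * Real.exp (t - 1)))
        measurableSet_Ioc, ← ofReal_integral_eq_lintegral_ofReal,
        ← intervalIntegral.integral_of_le h]
      · have hI : ∫ t in s..y, x * Real.exp (t - 1) =
            x * Real.exp (y - 1) - x * Real.exp (s - 1) := by
          refine intervalIntegral.integral_eq_sub_of_hasDerivAt
            (f := fun t => x * Real.exp (t - 1)) (fun t _ => ?_)
            (hcont.intervalIntegrable _ _)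
          simpa using (((hasDerivAt_id t).sub_const 1).exp).const_mul x
        have hxs : x * Real.exp (s - 1) = s := by
          rw [← hsx, mul_comm, exp_mul_mul_exp]
        have hle : x * Real.exp (s - 1) ≤ x * Real.exp (y - 1) :=
          mul_le_mul_of_nonneg_left (Real.exp_le_exp.mpr (by linarith)) hx.1
        rw [hI, ← ENNReal.ofReal_add hs.1 (by linarith)]
        congr 1
        linarith
      · exact (hcont.integrableOn_Icc (a := s) (b := y)).mono_set Ioc_subset_Icc_self
      · exact Eventually.of_forall fun t => mul_nonneg hx.1 (Real.exp_pos _).le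
      · intro t ht
        have ht' : t ∈ Icc (0 : ℝ) 1 := ⟨hs.1.trans ht.1.le, ht.2.trans hy.2⟩
        exact if_neg (mt (hiff t ht').mp (not_le.mpr ht.1))
    · rw [Set.disjoint_left]
      exact fun t h3 h4 => absurd h3.2 (not_le.mpr h4.1)

/-- The first marginal is read off the distribution function at y = 1, where the minimum is x;
finiteness of `R` lets half-lines determine it. -/
theorem isPermuton_R : IsPermuton R := by
  have hsnd : R.map Prod.snd = volume.restrict (Icc (0 : ℝ) 1) := by
    ext B hB
    rw [Measure.map_apply measurable_snd hB, ← univ_prod, R_univ_prod hB,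
      Measure.restrict_apply hB]
  have hfin : IsFiniteMeasure R := by
    constructor
    rw [← univ_prod_univ, R_univ_prod MeasurableSet.univ, univ_inter]
    simp
  refine ⟨?_, hsnd⟩
  have := Measure.isFiniteMeasure_map R Prod.fst
  refine Measure.ext_of_Iic _ _ fun x => ?_
  rw [Measure.map_apply measurable_fst measurableSet_Iic, ← prod_univ,
    Measure.restrict_apply measurableSet_Iic]
  have hIic : R (Iic x ×ˢ univ) = R (Iic x ×ˢ Iic 1) := by
    rw [R_Iic_prod x MeasurableSet.univ, R_Iic_prod x measurableSet_Iic, univ_inter,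
      inter_eq_self_of_subset_right Icc_subset_Iic_self]
  rcases lt_or_ge x 0 with h0 | h0
  · have hempty : Iic x ∩ Icc (0 : ℝ) 1 = ∅ := by
      ext t
      simp only [mem_inter_iff, mem_Iic, mem_Icc, mem_empty_iff_false, iff_false]
      rintro ⟨h1, h2, -⟩
      linarith
    rw [hempty, measure_empty, R_Iic_prod x MeasurableSet.univ, univ_inter, ← lintegral_zero]
    refine setLIntegral_congr_fun measurableSet_Icc fun t ht => ?_
    have hlt : ¬ t * Real.exp (1 - t) ≤ x := by
      have := (mul_exp_mem_Icc ht).1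
      linarith
    simp only [if_neg hlt]
    exact ENNReal.ofReal_of_nonpos (mul_nonpos_of_nonpos_of_nonneg h0.le (Real.exp_pos _).le)
  rcases le_or_gt x 1 with h1 | h1
  · have hset : Iic x ∩ Icc (0 : ℝ) 1 = Icc 0 x := by
      ext t
      simp only [mem_inter_iff, mem_Iic, mem_Icc]
      constructor
      · rintro ⟨h2, h3, -⟩
        exact ⟨h3, h2⟩
      · rintro ⟨h2, h3⟩
        exact ⟨h3, h2, h3.trans h1⟩
    rw [hIic, R_Iic_prod_Iic ⟨h0, h1⟩ (right_mem_Icc.mpr zero_le_one), hset, Real.volume_Icc]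
    simp [h1]
  · rw [inter_eq_self_of_subset_right fun t ht => ht.2.trans h1.le,
      R_Iic_prod x MeasurableSet.univ, univ_inter, ← setLIntegral_one]
    refine setLIntegral_congr_fun measurableSet_Icc fun t ht => ?_
    exact if_pos ((mul_exp_mem_Icc ht).2.trans h1.le)

/-- The joint distribution function of the runsort permuton on the unit square. -/
theorem jointCdf_R {x y : ℝ} (hx : x ∈ Icc (0 : ℝ) 1) (hy : y ∈ Icc (0 : ℝ) 1) :
    jointCdf R x y = min y (x * Real.exp (y - 1)) := by
  rw [jointCdf, Measure.real, R_Iic_prod_Iic hx hy, ENNReal.toReal_ofReal]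
  exact le_min hy.1 (mul_nonneg hx.1 (Real.exp_pos _).le)

end LimitMeasure

/-! ### Convergence of the measures and of the sums `E` -/

section Convergence

theorem abs_sub_floor_mul_div_le {n : ℕ} (hn : 0 < n) {t : ℝ} (ht : 0 ≤ t) :
    |t - (⌊t * n⌋₊ : ℝ) / n| ≤ 1 / n := by
  have hn' : (0 : ℝ) < n := by exact_mod_cast hn
  have h0 : 0 ≤ t * n := by positivity
  have h1 := Nat.floor_le h0
  have h2 := Nat.lt_floor_add_one (t * n)
  have : t - (⌊t * n⌋₊ : ℝ) / n = (t * n - ⌊t * n⌋₊) / n := by field_simp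
  rw [this, abs_of_nonneg (div_nonneg (by linarith) hn'.le)]
  gcongr
  linarith

theorem tendsto_jointCdf_meanMeasure {x y : ℝ} (hx : x ∈ Icc (0 : ℝ) 1) (hy : y ∈ Icc (0 : ℝ) 1) :
    Tendsto (fun n => jointCdf (meanMeasure n) x y) atTop (𝓝 (jointCdf R x y)) := by
  have hmain := tendsto_permAvg_runsortCount hx hy
  rw [← jointCdf_R hx hy] at hmain
  have hdiff : Tendsto (fun n : ℕ => jointCdf (meanMeasure n) x y -
      permAvg n fun π => (runsortCount π ⌊x * n⌋₊ ⌊y * n⌋₊ : ℝ) / n) atTop (𝓝 0) := by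
    -- Rounding `x` and `y` down to multiples of 1/n costs at most 1/n each, by the Lipschitz bound.
    refine squeeze_zero_norm' ?_ (tendsto_const_div_atTop_nhds_zero_nat (2 : ℝ))
    filter_upwards [eventually_gt_atTop 0] with n hn
    rw [Real.norm_eq_abs, ← jointCdf_meanMeasure hn]
    have h1 := (isPermuton_meanMeasure hn).abs_jointCdf_sub_le x y (⌊x * n⌋₊ / n) (⌊y * n⌋₊ / n)
    have h2 := abs_sub_floor_mul_div_le hn hx.1
    have h3 := abs_sub_floor_mul_div_le hn hy.1
    have h4 : (2 : ℝ) / n = 1 / n + 1 / n := by ring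
    linarith
  simpa using hdiff.add hmain

theorem tendsto_real_meanMeasure {x₁ x₂ y₁ y₂ : ℝ} (hx₁ : x₁ ∈ Icc (0 : ℝ) 1)
    (hx₂ : x₂ ∈ Icc (0 : ℝ) 1) (hx : x₁ ≤ x₂) (hy₁ : y₁ ∈ Icc (0 : ℝ) 1)
    (hy₂ : y₂ ∈ Icc (0 : ℝ) 1) (hy : y₁ ≤ y₂) :
    Tendsto (fun n => (meanMeasure n).real (Icc x₁ x₂ ×ˢ Icc y₁ y₂)) atTop
      (𝓝 (R.real (Icc x₁ x₂ ×ˢ Icc y₁ y₂))) := by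
  rw [isPermuton_R.real_Icc_prod_Icc hx hy]
  refine ((((tendsto_jointCdf_meanMeasure hx₂ hy₂).sub (tendsto_jointCdf_meanMeasure hx₁ hy₂)).sub
    (tendsto_jointCdf_meanMeasure hx₂ hy₁)).add (tendsto_jointCdf_meanMeasure hx₁ hy₁)).congr' ?_
  filter_upwards [eventually_gt_atTop 0] with n hn
  rw [(isPermuton_meanMeasure hn).real_Icc_prod_Icc hx hy]

theorem tendsto_dSquare : Tendsto (fun n => dSquare (meanMeasure n) R) atTop (𝓝 0) := by
  rw [ENNReal.tendsto_nhds_zero]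
  intro ε hε
  obtain ⟨δ, hδ, hδε⟩ := ENNReal.lt_iff_exists_real_btwn.mp hε
  have hδ0 : 0 < δ := by simpa using hδε.1
  have hperm : ∀ᶠ n in atTop, IsPermuton (meanMeasure n) := by
    filter_upwards [eventually_gt_atTop 0] with n hn
    exact isPermuton_meanMeasure hn
  -- Four values of the distribution function enter each rectangle, so each gets `δ / 4`.
  filter_upwards [hperm, isPermuton_R.eventually_abs_jointCdf_sub_le hperm
    (fun x hx y hy => tendsto_jointCdf_meanMeasure hx hy) (show 0 < δ / 4 by linarith)] with n hp hn
  refine iSup₂_le fun B hB => ?_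
  obtain ⟨x₁, x₂, y₁, y₂, hx0, hx, hx1, hy0, hy, hy1, rfl⟩ := hB
  refine le_trans (ENNReal.ofReal_le_ofReal ?_) hδε.2.le
  have hx₁ : x₁ ∈ Icc (0 : ℝ) 1 := ⟨hx0, hx.trans hx1⟩
  have hx₂ : x₂ ∈ Icc (0 : ℝ) 1 := ⟨hx0.trans hx, hx1⟩
  have hy₁ : y₁ ∈ Icc (0 : ℝ) 1 := ⟨hy0, hy.trans hy1⟩
  have hy₂ : y₂ ∈ Icc (0 : ℝ) 1 := ⟨hy0.trans hy, hy1⟩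
  rw [hp.real_Icc_prod_Icc hx hy, isPermuton_R.real_Icc_prod_Icc hx hy]
  have h1 := abs_le.mp (hn x₂ hx₂ y₂ hy₂)
  have h2 := abs_le.mp (hn x₁ hx₁ y₂ hy₂)
  have h3 := abs_le.mp (hn x₂ hx₂ y₁ hy₁)
  have h4 := abs_le.mp (hn x₁ hx₁ y₁ hy₁)
  rw [abs_le]
  constructor <;> linarith [h1.1, h1.2, h2.1, h2.2, h3.1, h3.2, h4.1, h4.2]

theorem p_eq_permAvg (n : ℕ) (i j : Fin n) :
    p n i j = permAvg n fun π => if runsort π i = j then 1 else 0 := by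
  simp [p, permAvg]

/-- The expected normalized number of entries of `runsort π` below `b` among the first `a`. -/
theorem permAvg_runsortCount_div (n a b : ℕ) :
    permAvg n (fun π => (runsortCount π a b : ℝ) / n) =
      1 / (n : ℝ) * ∑ i : Fin n, ∑ j : Fin n,
        (if (i : ℕ) < a then 1 else 0) * (if (j : ℕ) < b then 1 else 0) * p n i j := by
  have h : ∀ π : Equiv.Perm (Fin n), (runsortCount π a b : ℝ) = ∑ i : Fin n, ∑ j : Fin n,
      ((if (i : ℕ) < a then 1 else 0) * (if (j : ℕ) < b then 1 else 0)) *
        (if runsort π i = j then (1 : ℝ) else 0) := by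
    intro π
    simp only [runsortCount, Finset.card_filter, Nat.cast_sum]
    refine Finset.sum_congr rfl fun i _ => ?_
    simp only [mul_ite, mul_one, mul_zero, Finset.sum_ite_eq, Finset.mem_univ, if_true]
    split_ifs <;> simp_all
  simp only [p_eq_permAvg]
  rw [permAvg_div, one_div, inv_mul_eq_div]
  simp only [h, permAvg_sum, permAvg_mul_left]

/-- The entry with index `i` in `Fin n` is number i + 1 in the count from 1, which turns `≤` into a
strict inequality. -/
theorem floor_indicator (n : ℕ) {t : ℝ} (ht : 0 ≤ t) (i : Fin n) :
    (i : ℝ) + 1 ≤ t * n ↔ (i : ℕ) < ⌊t * n⌋₊ := by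
  rw [← Nat.succ_le_iff, Nat.le_floor_iff (by positivity)]
  push_cast
  rfl

theorem ite_Ioc_eq_sub (n : ℕ) {s t : ℝ} (hs : 0 ≤ s) (hst : s ≤ t) (i : Fin n)
    [Decidable (s * n < (i : ℝ) + 1 ∧ (i : ℝ) + 1 ≤ t * n)] :
    (if s * n < (i : ℝ) + 1 ∧ (i : ℝ) + 1 ≤ t * n then (1 : ℝ) else 0) =
      (if (i : ℕ) < ⌊t * n⌋₊ then 1 else 0) - if (i : ℕ) < ⌊s * n⌋₊ then 1 else 0 := by
  have h1 := floor_indicator n (hs.trans hst) i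
  have h2 := floor_indicator n hs i
  have h3 : ⌊s * n⌋₊ ≤ ⌊t * n⌋₊ := Nat.floor_mono (by gcongr)
  have h4 : s * n < (i : ℝ) + 1 ↔ ¬(i : ℕ) < ⌊s * n⌋₊ := by rw [← not_le, h2]
  simp only [h4, h1]
  split_ifs <;> first | omega | norm_num

theorem ite_and_eq_mul (P Q : Prop) [Decidable P] [Decidable Q] (a : ℝ) :
    (if P ∧ Q then a else 0) = (if P then 1 else 0) * (if Q then 1 else 0) * a := by
  split_ifs <;> simp_all

/-- The half-open ranges of summation make inclusion-exclusion exact for every `n`, so `E` converges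
by the limits of the counts, without passing through `meanMeasure`. -/
theorem E_eq (n : ℕ) {x₁ x₂ y₁ y₂ : ℝ} (hx₁ : 0 ≤ x₁) (hx : x₁ ≤ x₂) (hy₁ : 0 ≤ y₁)
    (hy : y₁ ≤ y₂) :
    E n x₁ x₂ y₁ y₂ =
      permAvg n (fun π => (runsortCount π ⌊x₂ * n⌋₊ ⌊y₂ * n⌋₊ : ℝ) / n) -
      permAvg n (fun π => (runsortCount π ⌊x₁ * n⌋₊ ⌊y₂ * n⌋₊ : ℝ) / n) -
      permAvg n (fun π => (runsortCount π ⌊x₂ * n⌋₊ ⌊y₁ * n⌋₊ : ℝ) / n) +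
      permAvg n (fun π => (runsortCount π ⌊x₁ * n⌋₊ ⌊y₁ * n⌋₊ : ℝ) / n) := by
  classical
  simp only [permAvg_runsortCount_div, E]
  rw [← mul_sub, ← mul_sub, ← mul_add]
  congr 1
  simp only [← Finset.sum_sub_distrib, ← Finset.sum_add_distrib]
  refine Finset.sum_congr rfl fun i _ => Finset.sum_congr rfl fun j _ => ?_
  have h1 := ite_Ioc_eq_sub n hx₁ hx i
  have h2 := ite_Ioc_eq_sub n hy₁ hy j
  have h3 := ite_and_eq_mul (x₁ * n < (i : ℝ) + 1 ∧ (i : ℝ) + 1 ≤ x₂ * n)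
    (y₁ * n < (j : ℝ) + 1 ∧ (j : ℝ) + 1 ≤ y₂ * n) (p n i j)
  rw [h1, h2] at h3
  refine Eq.trans ?_ (h3.trans ?_)
  · congr
  · ring

theorem tendsto_E {x₁ x₂ y₁ y₂ : ℝ} (hx₁ : x₁ ∈ Icc (0 : ℝ) 1)
    (hx₂ : x₂ ∈ Icc (0 : ℝ) 1) (hx : x₁ ≤ x₂) (hy₁ : y₁ ∈ Icc (0 : ℝ) 1)
    (hy₂ : y₂ ∈ Icc (0 : ℝ) 1) (hy : y₁ ≤ y₂) :
    Tendsto (fun n : ℕ => E n x₁ x₂ y₁ y₂) atTop (𝓝 (R.real (Icc x₁ x₂ ×ˢ Icc y₁ y₂))) := by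
  rw [isPermuton_R.real_Icc_prod_Icc hx hy, jointCdf_R hx₂ hy₂, jointCdf_R hx₁ hy₂,
    jointCdf_R hx₂ hy₁, jointCdf_R hx₁ hy₁]
  simp only [E_eq _ hx₁.1 hx hy₁.1 hy]
  exact (((tendsto_permAvg_runsortCount hx₂ hy₂).sub (tendsto_permAvg_runsortCount hx₁ hy₂)).sub
    (tendsto_permAvg_runsortCount hx₂ hy₁)).add (tendsto_permAvg_runsortCount hx₁ hy₁)

end Convergence

end RunsortPermuton

theorem theorem2p5 :
    (∀ x₁ x₂ y₁ y₂ : ℝ, 0 ≤ x₁ → x₁ ≤ x₂ → x₂ ≤ 1 → 0 ≤ y₁ → y₁ ≤ y₂ → y₂ ≤ 1 →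
      Filter.Tendsto (fun n : ℕ => RunsortPermuton.E n x₁ x₂ y₁ y₂) Filter.atTop
        (nhds (RunsortPermuton.R.real (Set.Icc x₁ x₂ ×ˢ Set.Icc y₁ y₂))) ∧
      Filter.Tendsto
        (fun n : ℕ => (RunsortPermuton.meanMeasure n).real (Set.Icc x₁ x₂ ×ˢ Set.Icc y₁ y₂))
        Filter.atTop
        (nhds (RunsortPermuton.R.real (Set.Icc x₁ x₂ ×ˢ Set.Icc y₁ y₂)))) ∧
    Filter.Tendsto
      (fun n : ℕ => RunsortPermuton.dSquare (RunsortPermuton.meanMeasure n) RunsortPermuton.R)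
      Filter.atTop (nhds 0) := by
  refine ⟨fun x₁ x₂ y₁ y₂ hx₁ hx hx₂ hy₁ hy hy₂ => ?_, RunsortPermuton.tendsto_dSquare⟩
  have h₁ : x₁ ∈ Set.Icc (0 : ℝ) 1 := ⟨hx₁, hx.trans hx₂⟩
  have h₂ : x₂ ∈ Set.Icc (0 : ℝ) 1 := ⟨hx₁.trans hx, hx₂⟩
  have h₃ : y₁ ∈ Set.Icc (0 : ℝ) 1 := ⟨hy₁, hy.trans hy₂⟩
  have h₄ : y₂ ∈ Set.Icc (0 : ℝ) 1 := ⟨hy₁.trans hy, hy₂⟩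
  exact ⟨RunsortPermuton.tendsto_E h₁ h₂ hx h₃ h₄ hy,
    RunsortPermuton.tendsto_real_meanMeasure h₁ h₂ hx h₃ h₄ hy⟩
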